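/- All Hilbert spaces are finite-dimensional and complex, $\mathcal B(\mathcal H)$ denotes the linear operators on $\mathcal H$, and $\mathbb N=\{1,2,\dots\}$. $\mathrm{CP}(\mathcal H,\mathcal K)$ is the set of completely positive linear maps $\mathcal B(\mathcal H)\to\mathcal B(\mathcal K)$; a channel is a trace-preserving such map; $\mathcal N\le_{\mathrm{CP}}\mathcal M$ means that $\mathcal M-\mathcal N$ is completely positive. A state is a positive semidefinite operator of trace $1$; a test is an operator $T$ with $0\le T\le I$. A supermap is a linear map $\Theta:\mathcal B(\mathcal B(\mathcal H_1),\mathcal B(\mathcal K_1))\to\mathcal B(\mathcal B(\mathcal H_2),\mathcal B(\mathcal K_2))$; it is completely positive if, acting on half of any bipartite completely positive map, it yields a completely positive map; a superchannel is a completely positive supermap that maps channels to channels. Let $n\in\mathbb N$ and let $\mathcal H_A,\mathcal H_B$ be given. - An $n$-copy *parallel strategy* $(\varphi,T)$ consists of a space $\mathcal H_R$, a state $\varphi$ on $\mathcal H_R\otimes\mathcal H_A^{\otimes n}$ and a test $T$ on $\mathcal H_R\otimes\mathcal H_B^{\otimes n}$. - An $n$-copy *adaptive strategy* $(\varphi,\vec{\mathcal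 A},T)$ consists of spaces $\mathcal H_{R_1},\dots,\mathcal H_{R_n}$, a state $\varphi$ on $\mathcal H_{R_1}\otimes\mathcal H_A$, channels $\mathcal A_i:\mathcal B(\mathcal H_{R_i}\otimes\mathcal H_B)\to\mathcal B(\mathcal H_{R_{i+1}}\otimes\mathcal H_A)$, $1\le i\le n-1$, and a test $T$ on $\mathcal H_{R_n}\otimes\mathcal H_B$. For $\mathcal F\in\mathrm{CP}(\mathcal H_A,\mathcal H_B)$ put $$\Theta_{\vec{\mathcal A}}(\mathcal F^{\otimes n}):=(\mathrm{id}_{R_n}\otimes\mathcal F)\circ\mathcal A_{n-1}\circ(\mathrm{id}_{R_{n-1}}\otimes\mathcal F)\circ\dots\circ\mathcal A_1\circ(\mathrm{id}_{R_1}\otimes\mathcal F).$$ - An $n$-copy *general strategy* $(\varphi,\Theta,T)$ consists of spaces $\mathcal H_R,\mathcal H_{A'},\mathcal H_{B'}$, a superchannel $\Theta:\mathcal B(\mathcal B(\mathcal H_A^{\otimes n}),\mathcal B(\mathcal H_B^{\otimes n}))\to\mathcal B(\mathcal B(\mathcal H_{A'}),\mathcal B(\mathcal H_{B'}))$, a state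 $\varphi$ on $\mathcal H_R\otimes\mathcal H_{A'}$ and a test $T$ on $\mathcal H_R\otimes\mathcal H_{B'}$. For positive semidefinite $P,Q$ and $t\in[0,1]$, the $t$-weighted Kubo–Ando geometric mean is $$Q\#_tP:=\lim_{\varepsilon\searrow0}Q_\varepsilon^{1/2}\big(Q_\varepsilon^{-1/2}P_\varepsilon Q_\varepsilon^{-1/2}\big)^tQ_\varepsilon^{1/2},\qquad P_\varepsilon:=P+\varepsilon I,\quad Q_\varepsilon:=Q+\varepsilon I.$$ For $\mathcal N,\mathcal M\in\mathrm{CP}(\mathcal H_A,\mathcal H_B)$, $\mathcal M\#_t\mathcal N$ is the linear map with $C(\mathcal M\#_t\mathcal N)=C(\mathcal M)\#_tC(\mathcal N)$, where $C(\mathcal F):=\sum_{i,j}|e_i\rangle\langle e_j|\otimes\mathcal F(|e_i\rangle\langle e_j|)$ is the Choi operator with respect to an orthonormal basis $(e_i)$ of $\mathcal H_A$. **Theorem.** Let $\mathcal Y$ be a non-empty finite set, and let $\mathcal N_y\in\mathrm{CP}(\mathcal H_A,\mathcal H_B)$, $y\in\mathcal Y$, and $\mathcal E\in\mathrm{CP}(\mathcal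 H_A,\mathcal H_B)$. The following are equivalent: 1. For every $n\in\mathbb N$ and every $n$-copy general strategy $(\varphi,\Theta,T)$, $$\operatorname{Tr}T(\mathrm{id}_R\otimes\Theta(\mathcal E^{\otimes n}))\varphi\le\max_{y\in\mathcal Y}\operatorname{Tr}T(\mathrm{id}_R\otimes\Theta(\mathcal N_y^{\otimes n}))\varphi.$$ 1′. The same inequality holds for every $n\in\mathbb N$ and all $(\varphi,\Theta,T)$ as in a general strategy, except that the completely positive supermap $\Theta$ is only required to map $\mathcal F^{\otimes n}$ to a channel for every channel $\mathcal F:\mathcal B(\mathcal H_A)\to\mathcal B(\mathcal H_B)$. 2. For every $n\in\mathbb N$ and every $n$-copy adaptive strategy $(\varphi,\vec{\mathcal A},T)$, $$\operatorname{Tr}T\,\Theta_{\vec{\mathcal A}}(\mathcal E^{\otimes n})\varphi\le\max_{y\in\mathcal Y}\operatorname{Tr}T\,\Theta_{\vec{\mathcal A}}(\mathcal N_y^{\otimes n})\varphi.$$ 3. For every $n\in\mathbb N$ and every $n$-copy parallel strategy $(\varphi,T)$, $$\operatorname{Tr}T(\mathrm{id}_R\otimes\mathcal E^{\otimes n})\varphi\le\max_{y\in\mathcal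 Y}\operatorname{Tr}T(\mathrm{id}_R\otimes\mathcal N_y^{\otimes n})\varphi.$$ 4. There is a probability measure $\mu$ on $\mathcal Y$ such that for every $n\in\mathbb N$, $$\mathcal E^{\otimes n}\le_{\mathrm{CP}}\sum_{y\in\mathcal Y}\mu(y)\,\mathcal N_y^{\otimes n}.$$ If, moreover, $\mathcal Y=\{1,2\}$ has exactly two elements, then these are further equivalent to: 5. There is a $t\in[0,1]$ such that $\mathcal N_2\#_t\mathcal N_1$ exists and $\mathcal E\le_{\mathrm{CP}}\mathcal N_2\#_t\mathcal N_1$. -/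

import Mathlib

open Filter Topology
open scoped ComplexOrder MatrixOrder Kronecker

universe u v w

/-- Superoperators `B(ℂ^A) → B(ℂ^B)`, where the finite type `A` labels an orthonormal basis of the
input space and the finite type `B` one of the output space. -/
abbrev Superop (A : Type u) (B : Type v) := Matrix A A ℂ →ₗ[ℂ] Matrix B B ℂ

/-- `id_R ⊗ N`, acting on `B(ℂ^R ⊗ ℂ^A)`. -/
def idTensor (R : Type w) {A : Type u} {B : Type v} (N : Superop A B) :
    Superop (R × A) (R × B) where
  toFun X := Matrix.of fun p q => N (Matrix.of fun a a' => X (p.1, a) (q.1, a')) p.2 q.2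
  map_add' X Y := by
    ext p q
    exact congrFun (congrFun (map_add N (Matrix.of fun a a' => X (p.1, a) (q.1, a'))
      (Matrix.of fun a a' => Y (p.1, a) (q.1, a'))) p.2) q.2
  map_smul' c X := by
    ext p q
    exact congrFun (congrFun (map_smul N c (Matrix.of fun a a' => X (p.1, a) (q.1, a'))) p.2) q.2

theorem idTensor_kronecker {R : Type w} {A : Type u} {B : Type v} (N : Superop A B)
    (X : Matrix R R ℂ) (Z : Matrix A A ℂ) : idTensor R N (X ⊗ₖ Z) = X ⊗ₖ N Z := by
  ext p q
  exact congrFun (congrFun (map_smul N (X p.1 q.1) Z) p.2) q.2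

/-- Complete positivity: `id_{ℂ^k} ⊗ N` preserves positive semidefiniteness for every `k`. -/
def IsCP {A : Type u} {B : Type v} (N : Superop A B) : Prop :=
  ∀ (k : ℕ) (X : Matrix (Fin k × A) (Fin k × A) ℂ),
    X.PosSemidef → (idTensor (Fin k) N X).PosSemidef

/-- Quantum channels: completely positive and trace-preserving superoperators. -/
def IsCPTP {A : Type u} {B : Type v} [Fintype A] [Fintype B] (N : Superop A B) : Prop :=
  IsCP N ∧ ∀ X : Matrix A A ℂ, (N X).trace = X.trace

/-- The order `N ≤_CP M`. -/
def CPLe {A : Type u} {B : Type v} (N M : Superop A B) : Prop := IsCP (M - N)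

/-- The tensor power `N^{⊗n}`, acting on `B((ℂ^A)^{⊗n})`, in matrix elements:
`N^{⊗n}` sends `|a₁⋯aₙ⟩⟨a'₁⋯a'ₙ|` to `N(|a₁⟩⟨a'₁|) ⊗ ⋯ ⊗ N(|aₙ⟩⟨a'ₙ|)`. -/
def tensorPow {A : Type u} {B : Type v} [Fintype A] [DecidableEq A] (n : ℕ) (N : Superop A B) :
    Superop (Fin n → A) (Fin n → B) where
  toFun X := Matrix.of fun b b' =>
    ∑ a, ∑ a', (∏ i, N (Matrix.single (a i) (a' i) 1) (b i) (b' i)) * X a a'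
  map_add' X Y := by
    ext b b'
    simp [mul_add, Finset.sum_add_distrib]
  map_smul' c X := by
    ext b b'
    simp [Finset.mul_sum, mul_left_comm]

/-- `N^{⊗n}(X₁ ⊗ ⋯ ⊗ Xₙ) = N(X₁) ⊗ ⋯ ⊗ N(Xₙ)`. -/
theorem tensorPow_prod {A : Type u} {B : Type v} [Fintype A] [DecidableEq A] (n : ℕ)
    (N : Superop A B) (X : Fin n → Matrix A A ℂ) :
    tensorPow n N (Matrix.of fun a a' => ∏ i, X i (a i) (a' i)) =
      Matrix.of fun b b' => ∏ i, N (X i) (b i) (b' i) := by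
  have key : ∀ (Z : Matrix A A ℂ) (b b' : B),
      N Z b b' = ∑ a, ∑ a', N (Matrix.single a a' 1) b b' * Z a a' := by
    intro Z b b'
    conv_lhs => rw [Matrix.matrix_eq_sum_single Z]
    simp only [map_sum, Matrix.sum_apply]
    refine Finset.sum_congr rfl fun a _ => Finset.sum_congr rfl fun a' _ => ?_
    have h : Matrix.single a a' (Z a a') = Z a a' • Matrix.single a a' (1 : ℂ) := by
      simp [Matrix.smul_single]
    rw [h, map_smul, Matrix.smul_apply, smul_eq_mul, mul_comm]
  ext b b'
  simp only [tensorPow, LinearMap.coe_mk, AddHom.coe_mk, Matrix.of_apply, key (X _),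
    Finset.prod_univ_sum, Fintype.piFinset_univ, ← Finset.prod_mul_distrib]

/-- Density operators. -/
def IsState {A : Type u} [Fintype A] (φ : Matrix A A ℂ) : Prop := φ.PosSemidef ∧ φ.trace = 1

/-- Tests: `0 ≤ T ≤ I`. -/
def IsTest {A : Type u} [DecidableEq A] (T : Matrix A A ℂ) : Prop :=
  T.PosSemidef ∧ (1 - T).PosSemidef

/-- The component of a bipartite superoperator `Λ` at `|c⟩⟨c'| ↦ |d⟩⟨d'|` in the first factor:
`X ↦ ⟨d| Λ(|c⟩⟨c'| ⊗ X) |d'⟩`. -/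
def superopBlock {C D : Type w} {A : Type u} {B : Type v} [DecidableEq C]
    (Λ : Superop (C × A) (D × B)) (c c' : C) (d d' : D) : Superop A B where
  toFun X := Matrix.of fun b b' => Λ (Matrix.single c c' 1 ⊗ₖ X) (d, b) (d', b')
  map_add' X Y := by
    ext b b'
    simp [Matrix.kronecker_add]
  map_smul' r X := by
    ext b b'
    simp [Matrix.kronecker_smul]

/-- The action of a supermap `Θ` on the second half of a bipartite superoperator: `Θ` is applied
to each component with respect to the first factor. -/
def supermapOnHalf {C D : Type w} {A A' : Type u} {B B' : Type v} [Fintype C] [DecidableEq C]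
    (Θ : Superop A B →ₗ[ℂ] Superop A' B') (Λ : Superop (C × A) (D × B)) :
    Superop (C × A') (D × B') where
  toFun X := Matrix.of fun p q => ∑ c, ∑ c',
    Θ (superopBlock Λ c c' p.1 q.1) (Matrix.of fun a a' => X (c, a) (c', a')) p.2 q.2
  map_add' X Y := by
    ext p q
    simp only [Matrix.of_apply, Matrix.add_apply, ← Finset.sum_add_distrib]
    refine Finset.sum_congr rfl fun c _ => Finset.sum_congr rfl fun c' _ => ?_
    exact congrFun (congrFun (map_add (Θ (superopBlock Λ c c' p.1 q.1))
      (Matrix.of fun a a' => X (c, a) (c', a'))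
      (Matrix.of fun a a' => Y (c, a) (c', a'))) p.2) q.2
  map_smul' r X := by
    ext p q
    simp only [Matrix.of_apply, Matrix.smul_apply, Finset.smul_sum, RingHom.id_apply]
    refine Finset.sum_congr rfl fun c _ => Finset.sum_congr rfl fun c' _ => ?_
    exact congrFun (congrFun (map_smul (Θ (superopBlock Λ c c' p.1 q.1)) r
      (Matrix.of fun a a' => X (c, a) (c', a'))) p.2) q.2

/-- If `Λ = M ⊗ N` then `supermapOnHalf Θ Λ = M ⊗ Θ(N)`. -/
theorem supermapOnHalf_tensor {C D : Type w} {A A' : Type u} {B B' : Type v} [Fintype C]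
    [DecidableEq C] (Θ : Superop A B →ₗ[ℂ] Superop A' B') (M : Superop C D) (N : Superop A B)
    (Λ : Superop (C × A) (D × B)) (h : ∀ Z X, Λ (Z ⊗ₖ X) = M Z ⊗ₖ N X)
    (Z : Matrix C C ℂ) (X : Matrix A' A' ℂ) :
    supermapOnHalf Θ Λ (Z ⊗ₖ X) = M Z ⊗ₖ Θ N X := by
  have hb : ∀ c c' d d', superopBlock Λ c c' d d' = M (Matrix.single c c' 1) d d' • N := by
    intro c c' d d'
    ext1 X
    ext b b'
    simp [superopBlock, h]
  have hX : ∀ c c', (Matrix.of fun a a' => (Z ⊗ₖ X) (c, a) (c', a')) = Z c c' • X := by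
    intro c c'; ext a a'; simp
  ext p q
  simp only [supermapOnHalf, LinearMap.coe_mk, AddHom.coe_mk, Matrix.of_apply, hb, hX, map_smul,
    LinearMap.smul_apply, Matrix.smul_apply, smul_eq_mul]
  rw [Matrix.kroneckerMap_apply]
  conv_rhs => rw [Matrix.matrix_eq_sum_single Z]
  simp only [map_sum, Matrix.sum_apply, Finset.sum_mul]
  refine Finset.sum_congr rfl fun c _ => Finset.sum_congr rfl fun c' _ => ?_
  have h2 : Matrix.single c c' (Z c c') = Z c c' • Matrix.single c c' (1 : ℂ) := by
    simp [Matrix.smul_single]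
  rw [h2, map_smul, Matrix.smul_apply, smul_eq_mul]; ring

/-- Completely positive supermaps: acting on half of a completely positive bipartite superoperator
they give a completely positive superoperator. -/
def IsCPSupermap {A A' : Type u} {B B' : Type v}
    (Θ : Superop A B →ₗ[ℂ] Superop A' B') : Prop :=
  ∀ (k l : ℕ) (Λ : Superop (Fin k × A) (Fin l × B)), IsCP Λ → IsCP (supermapOnHalf Θ Λ)

/-- Superchannels: completely positive supermaps that map channels to channels. -/
def IsSuperchannel {A A' : Type u} {B B' : Type v} [Fintype A] [Fintype A'] [Fintype B]
    [Fintype B'] (Θ : Superop A B →ₗ[ℂ] Superop A' B') : Prop :=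
  IsCPSupermap Θ ∧ ∀ N : Superop A B, IsCPTP N → IsCPTP (Θ N)

/-- Completely positive supermaps for which only the `n`-th tensor powers of channels are
required to be mapped to channels. -/
def IsTensorPowSuperchannel {A A' : Type u} {B B' : Type v} [Fintype A] [DecidableEq A]
    [Fintype A'] [Fintype B] [Fintype B'] (n : ℕ)
    (Θ : Superop (Fin n → A) (Fin n → B) →ₗ[ℂ] Superop A' B') : Prop :=
  IsCPSupermap Θ ∧ ∀ N : Superop A B, IsCPTP N → IsCPTP (Θ (tensorPow n N))

/-- `S_𝒜(E^{⊗(k+1)})` for an adaptive strategy with reference systems `R 0, R 1, …` and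
intermediate channels `𝒜 0, 𝒜 1, …`: the superoperator `E` is used `k + 1` times, with `𝒜 i`
between the uses number `i + 1` and `i + 2` (`𝒜 i` with `i ≥ k` plays no role). -/
def adaptiveSuperop {A : Type u} {B : Type v} (E : Superop A B) (R : ℕ → Type w)
    (𝒜 : ∀ i, Superop (R i × B) (R (i + 1) × A)) : ∀ k : ℕ, Superop (R 0 × A) (R k × B)
  | 0 => idTensor (R 0) E
  | k + 1 => idTensor (R (k + 1)) E ∘ₗ 𝒜 k ∘ₗ adaptiveSuperop E R 𝒜 k

section Domination

variable {A B : Type u} [Fintype A] [DecidableEq A] [Fintype B] [DecidableEq B]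
  {Y : Type v} [Fintype Y] [Nonempty Y]

/-- `E` is dominated by the maximum of the `N y` for all general strategies `(φ, Θ, T)`. -/
def DominatedGeneral (N : Y → Superop A B) (E : Superop A B) : Prop :=
  ∀ n : ℕ, 1 ≤ n →
    ∀ (R A' B' : Type u) [Fintype R] [DecidableEq R] [Fintype A'] [DecidableEq A']
      [Fintype B'] [DecidableEq B']
      (Θ : Superop (Fin n → A) (Fin n → B) →ₗ[ℂ] Superop A' B')
      (φ : Matrix (R × A') (R × A') ℂ) (T : Matrix (R × B') (R × B') ℂ),
      IsSuperchannel Θ → IsState φ → IsTest T →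
      (T * idTensor R (Θ (tensorPow n E)) φ).trace.re ≤
        Finset.univ.sup' Finset.univ_nonempty
          fun y => (T * idTensor R (Θ (tensorPow n (N y))) φ).trace.re

/-- The same as `DominatedGeneral`, for the larger class of supermaps that are only required to
map tensor powers of channels to channels. -/
def DominatedTensorPowGeneral (N : Y → Superop A B) (E : Superop A B) : Prop :=
  ∀ n : ℕ, 1 ≤ n →
    ∀ (R A' B' : Type u) [Fintype R] [DecidableEq R] [Fintype A'] [DecidableEq A']
      [Fintype B'] [DecidableEq B']
      (Θ : Superop (Fin n → A) (Fin n → B) →ₗ[ℂ] Superop A' B')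
      (φ : Matrix (R × A') (R × A') ℂ) (T : Matrix (R × B') (R × B') ℂ),
      IsTensorPowSuperchannel n Θ → IsState φ → IsTest T →
      (T * idTensor R (Θ (tensorPow n E)) φ).trace.re ≤
        Finset.univ.sup' Finset.univ_nonempty
          fun y => (T * idTensor R (Θ (tensorPow n (N y))) φ).trace.re

/-- `E` is dominated by the maximum of the `N y` for all `n`-copy adaptive strategies `(φ, 𝒜, T)`,
where `n = m + 1` and `𝒜 0, …, 𝒜 (m - 1)` are the intermediate channels. -/
def DominatedAdaptive (N : Y → Superop A B) (E : Superop A B) : Prop :=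
  ∀ (m : ℕ) (R : ℕ → Type u) [∀ i, Fintype (R i)] [∀ i, DecidableEq (R i)]
    (𝒜 : ∀ i, Superop (R i × B) (R (i + 1) × A))
    (φ : Matrix (R 0 × A) (R 0 × A) ℂ) (T : Matrix (R m × B) (R m × B) ℂ),
    (∀ i, i < m → IsCPTP (𝒜 i)) → IsState φ → IsTest T →
    (T * adaptiveSuperop E R 𝒜 m φ).trace.re ≤
      Finset.univ.sup' Finset.univ_nonempty
        fun y => (T * adaptiveSuperop (N y) R 𝒜 m φ).trace.re

/-- `E` is dominated by the maximum of the `N y` for all parallel strategies `(φ, T)`. -/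
def DominatedParallel (N : Y → Superop A B) (E : Superop A B) : Prop :=
  ∀ n : ℕ, 1 ≤ n →
    ∀ (R : Type u) [Fintype R] [DecidableEq R]
      (φ : Matrix (R × (Fin n → A)) (R × (Fin n → A)) ℂ)
      (T : Matrix (R × (Fin n → B)) (R × (Fin n → B)) ℂ),
      IsState φ → IsTest T →
      (T * idTensor R (tensorPow n E) φ).trace.re ≤
        Finset.univ.sup' Finset.univ_nonempty
          fun y => (T * idTensor R (tensorPow n (N y)) φ).trace.re

/-- A single probability measure `μ` on `Y` satisfies `E^{⊗n} ≤_CP ∑ y, μ(y) N_y^{⊗n}` for all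
`n ≥ 1`. -/
def DominatedMixture (N : Y → Superop A B) (E : Superop A B) : Prop :=
  ∃ μ : Y → ℝ, μ ∈ stdSimplex ℝ Y ∧ ∀ n : ℕ, 1 ≤ n →
    CPLe (tensorPow n E) (∑ y, (μ y : ℂ) • tensorPow n (N y))

end Domination

/-- `Q #_t P = Q^{1/2} (Q^{-1/2} P Q^{-1/2})^t Q^{1/2}` for positive definite `P` and `Q`; powers
are taken in the continuous functional calculus. -/
noncomputable def geomMeanPosDef {ι : Type u} [Fintype ι] [DecidableEq ι] (t : ℝ)
    (Q P : Matrix ι ι ℂ) : Matrix ι ι ℂ :=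
  Q ^ (1 / 2 : ℝ) * (Q ^ (-1 / 2 : ℝ) * P * Q ^ (-1 / 2 : ℝ)) ^ t * Q ^ (1 / 2 : ℝ)

/-- `G` is the `t`-weighted Kubo–Ando mean `Q #_t P` of the positive semidefinite `P` and `Q`. -/
def IsKuboAndoMean {ι : Type u} [Fintype ι] [DecidableEq ι] (t : ℝ) (Q P G : Matrix ι ι ℂ) :
    Prop :=
  Tendsto (fun ε : ℝ => geomMeanPosDef t (Q + (ε : ℂ) • 1) (P + (ε : ℂ) • 1)) (𝓝[>] 0) (𝓝 G)

/-- The Choi matrix `(id ⊗ N)(|Ψ⟩⟨Ψ|)` for the Choi vector `Ψ = ∑ a, e_a ⊗ e_a`. -/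
def choi {A : Type u} {B : Type v} [DecidableEq A] (N : Superop A B) :
    Matrix (A × B) (A × B) ℂ :=
  Matrix.of fun p q => N (Matrix.single p.1 q.1 1) p.2 q.2

/-- `G` is the `t`-weighted Kubo–Ando mean `M #_t N` of the completely positive maps `M` and `N`:
the Choi matrix of `G` is the mean of the Choi matrices. -/
def IsKuboAndoMeanCP {A B : Type u} [Fintype A] [DecidableEq A] [Fintype B] [DecidableEq B]
    (t : ℝ) (M N G : Superop A B) : Prop :=
  IsKuboAndoMean t (choi M) (choi N) (choi G)

/-! Let `S` and `P y` be the Choi matrices of `E` and `N y`; Choi matrices of tensor powers are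
tensor powers of Choi matrices up to reindexing. A maximally entangled input and rank-one tests turn
the parallel condition into: for all n and w there is a y with ⟨w, S^{⊗n} w⟩ ≤ ⟨w, P_y^{⊗n} w⟩. Here
y may depend on n and w, and the crux is to replace this choice by one measure μ.

The vectors of ratios ⟨w, P_y^{⊗n} w⟩ / ⟨w, S^{⊗n} w⟩, indexed by y, multiply when the vectors w are
tensored. They form a monoid, each element of which has an entry at least 1. Taking logarithms and
separating from an open negative orthant yields μ with ⟨w, S^{⊗n} w⟩ ≤ ∏_y ⟨w, P_y^{⊗n} w⟩^{μ(y)}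
for all n and w (`exists_stdSimplex_quadForm_le_prod`). The inequality of arithmetic and geometric
means then gives the mixture condition.

Conversely, the mixture inequality survives completely positive processing, and an average is at
most a maximum. For adaptive strategies the copies are contracted one at a time against their Choi
factors (`posSemidef_sum_kronecker_adaptiveSuperop`). Parallel strategies are special cases of both
the general and the adaptive ones.

For two maps, the geometric bound characterizes the Kubo–Ando mean. In the positive definite case, a
congruence diagonalizes both matrices; Hölder's inequality shows that the mean satisfies the bound
(`quadForm_geomMeanPosDef_le`), and pinching onto type classes, which costs only a polynomial factor
in n, shows that it is the largest such matrix (`posSemidef_geomMeanPosDef_sub`). Monotonicity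
follows from this maximality, hence so does the existence of the limit ε ↘ 0 in the singular case.
-/

/-- The tensor power of a matrix. -/
def matTensorPow {ι κ : Type*} (n : ℕ) (C : Matrix ι κ ℂ) :
    Matrix (Fin n → ι) (Fin n → κ) ℂ :=
  Matrix.of fun a b => ∏ i, C (a i) (b i)

@[simp]
theorem matTensorPow_apply {ι κ : Type*} (n : ℕ) (C : Matrix ι κ ℂ) (a : Fin n → ι)
    (b : Fin n → κ) : matTensorPow n C a b = ∏ i, C (a i) (b i) := rfl

/-- The real part of the quadratic form of a matrix. -/
def quadForm {ι : Type*} [Fintype ι] (C : Matrix ι ι ℂ) (v : ι → ℂ) : ℝ :=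
  (star v ⬝ᵥ C.mulVec v).re

/-! ### Tensor powers of matrices -/

section TensorPow

variable {ι κ l : Type*}

theorem matTensorPow_mul [Fintype κ] (n : ℕ) (C : Matrix ι κ ℂ) (D : Matrix κ l ℂ) :
    matTensorPow n (C * D) = matTensorPow n C * matTensorPow n D := by
  classical
  ext a b
  simp only [matTensorPow_apply, Matrix.mul_apply, Finset.prod_univ_sum, Fintype.piFinset_univ,
    Finset.prod_mul_distrib]

theorem matTensorPow_conjTranspose (n : ℕ) (C : Matrix ι κ ℂ) :
    matTensorPow n C.conjTranspose = (matTensorPow n C).conjTranspose := by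
  ext a b
  simp [Matrix.conjTranspose_apply]

theorem matTensorPow_diagonal [DecidableEq ι] (n : ℕ) (d : ι → ℂ) :
    matTensorPow n (Matrix.diagonal d) = Matrix.diagonal fun a => ∏ i, d (a i) := by
  ext a b
  rw [matTensorPow_apply, Matrix.diagonal_apply]
  split_ifs with h
  · subst h; simp
  · obtain ⟨i, hi⟩ := Function.ne_iff.1 h
    exact Finset.prod_eq_zero (Finset.mem_univ i) (Matrix.diagonal_apply_ne _ hi)

theorem matTensorPow_one [DecidableEq ι] (n : ℕ) :
    matTensorPow n (1 : Matrix ι ι ℂ) = 1 := by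
  rw [← Matrix.diagonal_one, matTensorPow_diagonal]
  simp

theorem matTensorPow_succ (n : ℕ) (C : Matrix ι κ ℂ) :
    matTensorPow (n + 1) C =
      (C ⊗ₖ matTensorPow n C).submatrix (fun a => (a 0, Fin.tail a)) fun b => (b 0, Fin.tail b) := by
  ext a b
  simp [Fin.prod_univ_succ, Fin.tail]

theorem Matrix.PosSemidef.exists_eq_conjTranspose_mul_self [Fintype ι] {C : Matrix ι ι ℂ}
    (hC : C.PosSemidef) : ∃ D : Matrix ι ι ℂ, C = D.conjTranspose * D := by
  classical
  obtain ⟨D, hD⟩ := CStarAlgebra.nonneg_iff_eq_star_mul_self.1 hC.nonneg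
  exact ⟨D, hD⟩

theorem Matrix.PosSemidef.matTensorPow [Fintype ι] {C : Matrix ι ι ℂ} (hC : C.PosSemidef)
    (n : ℕ) : (matTensorPow n C).PosSemidef := by
  obtain ⟨D, rfl⟩ := hC.exists_eq_conjTranspose_mul_self
  rw [matTensorPow_mul, matTensorPow_conjTranspose]
  exact Matrix.posSemidef_conjTranspose_mul_self _

/-- Telescoping: D ⊗ Dₙ − C ⊗ Cₙ = (D − C) ⊗ Dₙ + C ⊗ (Dₙ − Cₙ), where the subscript denotes the
n-th tensor power. -/
theorem matTensorPow_sub_posSemidef [Fintype ι] {C D : Matrix ι ι ℂ} (hC : C.PosSemidef)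
    (hCD : (D - C).PosSemidef) (n : ℕ) :
    (matTensorPow n D - matTensorPow n C).PosSemidef := by
  have hD : D.PosSemidef := by simpa using hCD.add hC
  induction n with
  | zero =>
    have : matTensorPow 0 D - matTensorPow 0 C = 0 := by ext; simp
    rw [this]; exact Matrix.PosSemidef.zero
  | succ n ih =>
    have h : (D - C) ⊗ₖ matTensorPow n D + C ⊗ₖ (matTensorPow n D - matTensorPow n C) =
        D ⊗ₖ matTensorPow n D - C ⊗ₖ matTensorPow n C := by
      ext; simp; ring
    rw [matTensorPow_succ, matTensorPow_succ]
    have h' := (hCD.kronecker (hD.matTensorPow n)).add (hC.kronecker ih)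
    rw [h] at h'
    exact h'.submatrix fun a : Fin (n + 1) → ι => (a 0, Fin.tail a)

theorem Matrix.IsHermitian.matTensorPow {C : Matrix ι ι ℂ} (hC : C.IsHermitian) (n : ℕ) :
    (matTensorPow n C).IsHermitian := by
  rw [Matrix.IsHermitian, ← matTensorPow_conjTranspose, hC.eq]

theorem continuous_matTensorPow (n : ℕ) :
    Continuous (matTensorPow n : Matrix ι κ ℂ → _) := by
  refine continuous_matrix fun a b => ?_
  simp only [matTensorPow_apply]
  fun_prop

end TensorPow

/-! ### Quadratic forms and their behaviour under tensor products -/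

section QuadForm

variable {ι κ : Type*} [Fintype ι] [Fintype κ]

theorem Matrix.PosSemidef.quadForm_nonneg {C : Matrix ι ι ℂ} (hC : C.PosSemidef) (v : ι → ℂ) :
    0 ≤ quadForm C v :=
  hC.re_dotProduct_nonneg v

theorem Matrix.IsHermitian.dotProduct_mulVec_eq {C : Matrix ι ι ℂ} (hC : C.IsHermitian)
    (v : ι → ℂ) : star v ⬝ᵥ C.mulVec v = (quadForm C v : ℂ) := by
  refine Complex.ext rfl ?_
  simpa using hC.im_star_dotProduct_mulVec_self v

theorem posSemidef_of_quadForm_nonneg {C : Matrix ι ι ℂ} (hC : C.IsHermitian)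
    (h : ∀ v, 0 ≤ quadForm C v) : C.PosSemidef := by
  refine Matrix.posSemidef_iff_dotProduct_mulVec.2 ⟨hC, fun v => ?_⟩
  rw [hC.dotProduct_mulVec_eq]
  exact_mod_cast h v

theorem quadForm_sub (C D : Matrix ι ι ℂ) (v : ι → ℂ) :
    quadForm (C - D) v = quadForm C v - quadForm D v := by
  simp [quadForm, Matrix.sub_mulVec]

theorem quadForm_le_of_posSemidef_sub {C D : Matrix ι ι ℂ} (h : (D - C).PosSemidef) (v : ι → ℂ) :
    quadForm C v ≤ quadForm D v := by
  have := h.quadForm_nonneg v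
  rw [quadForm_sub] at this
  linarith

theorem posSemidef_sub_of_quadForm_le {C D : Matrix ι ι ℂ} (hC : C.IsHermitian)
    (hD : D.IsHermitian) (h : ∀ v, quadForm C v ≤ quadForm D v) : (D - C).PosSemidef :=
  posSemidef_of_quadForm_nonneg (hD.sub hC) fun v => by
    rw [quadForm_sub]; linarith [h v]

theorem quadForm_conj (M : Matrix ι κ ℂ) (C : Matrix ι ι ℂ) (v : κ → ℂ) :
    quadForm (M.conjTranspose * C * M) v = quadForm C (M.mulVec v) := by
  simp only [quadForm, ← Matrix.mulVec_mulVec, Matrix.star_mulVec, Matrix.dotProduct_mulVec,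
    Matrix.vecMul_vecMul]

theorem quadForm_mul_mul_conjTranspose (M : Matrix ι κ ℂ) (C : Matrix κ κ ℂ) (v : ι → ℂ) :
    quadForm (M * C * M.conjTranspose) v = quadForm C (M.conjTranspose.mulVec v) := by
  simpa using quadForm_conj M.conjTranspose C v

theorem quadForm_matTensorPow_conj (n : ℕ) (M : Matrix ι κ ℂ) (C : Matrix κ κ ℂ)
    (w : (Fin n → ι) → ℂ) :
    quadForm (matTensorPow n (M * C * M.conjTranspose)) w =
      quadForm (matTensorPow n C) ((matTensorPow n M).conjTranspose.mulVec w) := by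
  rw [matTensorPow_mul, matTensorPow_mul, matTensorPow_conjTranspose,
    quadForm_mul_mul_conjTranspose]

theorem quadForm_diagonal [DecidableEq ι] (d : ι → ℝ) (v : ι → ℂ) :
    quadForm (Matrix.diagonal fun i => (d i : ℂ)) v = ∑ i, d i * Complex.normSq (v i) := by
  simp only [quadForm, dotProduct, Matrix.mulVec_diagonal, Complex.re_sum]
  refine Finset.sum_congr rfl fun i _ => ?_
  simp [Complex.normSq_apply]
  ring

theorem quadForm_one [DecidableEq ι] (v : ι → ℂ) :
    quadForm (1 : Matrix ι ι ℂ) v = ∑ i, Complex.normSq (v i) := by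
  rw [← Matrix.diagonal_one]
  simpa using quadForm_diagonal (fun _ : ι => (1 : ℝ)) v

theorem quadForm_submatrix (e : κ ≃ ι) (C : Matrix ι ι ℂ) (v : κ → ℂ) :
    quadForm (C.submatrix e e) v = quadForm C (v ∘ e.symm) := by
  simp only [quadForm, Matrix.submatrix_mulVec_equiv]
  congr 1
  exact Fintype.sum_equiv e _ _ fun i => by simp

theorem continuous_quadForm (v : ι → ℂ) : Continuous fun C : Matrix ι ι ℂ => quadForm C v := by
  unfold quadForm
  fun_prop

theorem quadForm_kronecker {C : Matrix ι ι ℂ} {D : Matrix κ κ ℂ} (hC : C.IsHermitian)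
    (hD : D.IsHermitian) (v : ι → ℂ) (w : κ → ℂ) :
    quadForm (C ⊗ₖ D) (fun p => v p.1 * w p.2) = quadForm C v * quadForm D w := by
  have h : star (fun p : ι × κ => v p.1 * w p.2) ⬝ᵥ (C ⊗ₖ D).mulVec (fun p => v p.1 * w p.2) =
      (star v ⬝ᵥ C.mulVec v) * (star w ⬝ᵥ D.mulVec w) := by
    have hm : (C ⊗ₖ D).mulVec (fun p => v p.1 * w p.2) =
        fun p => C.mulVec v p.1 * D.mulVec w p.2 := by
      ext p
      simp only [Matrix.mulVec, dotProduct, Finset.sum_mul_sum, Fintype.sum_prod_type,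
        Matrix.kroneckerMap_apply]
      exact Finset.sum_congr rfl fun i _ => Finset.sum_congr rfl fun j _ => by ring
    rw [hm]
    simp only [dotProduct, Finset.sum_mul_sum, Fintype.sum_prod_type, Pi.star_apply, star_mul]
    exact Finset.sum_congr rfl fun i _ => Finset.sum_congr rfl fun j _ => by ring
  rw [hC.dotProduct_mulVec_eq, hD.dotProduct_mulVec_eq] at h
  unfold quadForm at *
  rw [h, ← Complex.ofReal_mul, Complex.ofReal_re]

/-- This multiplicativity makes the ratio vectors in `exists_stdSimplex_quadForm_le_prod` a monoid.
-/
theorem quadForm_matTensorPow_append {C : Matrix ι ι ℂ} (hC : C.IsHermitian) (m n : ℕ)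
    (v : (Fin m → ι) → ℂ) (w : (Fin n → ι) → ℂ) :
    quadForm (matTensorPow (m + n) C)
        (fun a => v (fun i => a (Fin.castAdd n i)) * w fun i => a (Fin.natAdd m i)) =
      quadForm (matTensorPow m C) v * quadForm (matTensorPow n C) w := by
  rw [← quadForm_kronecker (hC.matTensorPow m) (hC.matTensorPow n)]
  have h : matTensorPow (m + n) C = (matTensorPow m C ⊗ₖ matTensorPow n C).submatrix
      (Fin.appendEquiv m n).symm (Fin.appendEquiv m n).symm := by
    ext a b
    simp [Fin.prod_univ_add, Fin.appendEquiv]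
  rw [h, quadForm_submatrix]
  congr 1
  ext p
  simp [Fin.appendEquiv]

theorem quadForm_matTensorPow_prod {C : Matrix ι ι ℂ} (hC : C.IsHermitian) (n : ℕ) (v : ι → ℂ) :
    quadForm (matTensorPow n C) (fun a => ∏ i, v (a i)) = quadForm C v ^ n := by
  classical
  have h : star (fun a : Fin n → ι => ∏ i, v (a i)) ⬝ᵥ
      (matTensorPow n C).mulVec (fun a => ∏ i, v (a i)) = (star v ⬝ᵥ C.mulVec v) ^ n := by
    simp only [dotProduct, Matrix.mulVec, matTensorPow_apply, Pi.star_apply, star_prod]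
    rw [← Fin.prod_const, Finset.prod_univ_sum, Fintype.piFinset_univ]
    refine Finset.sum_congr rfl fun a _ => ?_
    rw [Finset.prod_mul_distrib, Finset.prod_univ_sum, Fintype.piFinset_univ]
    simp only [Finset.prod_mul_distrib]
  rw [hC.dotProduct_mulVec_eq] at h
  rw [quadForm, h, ← Complex.ofReal_pow, Complex.ofReal_re]

/-- Cauchy–Schwarz in the form of a pinching inequality: cutting a vector into pieces costs a factor
equal to the number of pieces. -/
theorem quadForm_sum_le {C : Matrix ι ι ℂ} (hC : C.PosSemidef) {σ : Type*} (s : Finset σ)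
    (v : σ → ι → ℂ) :
    quadForm C (∑ k ∈ s, v k) ≤ s.card * ∑ k ∈ s, quadForm C (v k) := by
  classical
  obtain ⟨D, rfl⟩ := hC.exists_eq_conjTranspose_mul_self
  have h (x : ι → ℂ) : quadForm (D.conjTranspose * D) x = ∑ i, ‖D.mulVec x i‖ ^ 2 := by
    have := quadForm_conj D 1 x
    rw [Matrix.mul_one] at this
    rw [this, quadForm_one]
    simp [Complex.normSq_eq_norm_sq]
  simp only [h]
  rw [Finset.sum_comm, Finset.mul_sum]
  refine Finset.sum_le_sum fun i _ => ?_
  rw [Matrix.mulVec_sum, Finset.sum_apply]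
  calc ‖∑ k ∈ s, D.mulVec (v k) i‖ ^ 2 ≤ (∑ k ∈ s, ‖D.mulVec (v k) i‖) ^ 2 := by
        gcongr; exact norm_sum_le _ _
    _ ≤ _ := sq_sum_le_card_mul_sum_sq

end QuadForm

/-! ### From a choice depending on the strategy to a single measure -/

/-- Weighted Gordan alternative: if no element of a semigroup of real vectors is strictly negative
on `s`, then some probability vector supported on `s` is nonnegative on it. -/
theorem exists_stdSimplex_nonneg_of_addSubmonoid {Y : Type*} [Fintype Y] (s : Finset Y)
    (K : AddSubmonoid (Y → ℝ)) (hK : ∀ x ∈ K, ∃ y ∈ s, 0 ≤ x y) :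
    ∃ μ ∈ stdSimplex ℝ Y, (∀ y ∉ s, μ y = 0) ∧ ∀ x ∈ K, 0 ≤ ∑ y, μ y * x y := by
  classical
  -- Allowing division by positive integers makes the monoid stable under nonnegative rational
  -- multiples, so its closure is a convex cone.
  let D₀ : AddSubmonoid (Y → ℝ) :=
    { carrier := {x | ∃ k : ℕ, 0 < k ∧ k • x ∈ K}
      zero_mem' := ⟨1, one_pos, by simp⟩
      add_mem' := by
        rintro x y ⟨k, hk, hx⟩ ⟨l, hl, hy⟩
        refine ⟨k * l, Nat.mul_pos hk hl, ?_⟩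
        rw [smul_add, mul_comm, mul_smul, mul_comm, mul_smul]
        exact K.add_mem (K.nsmul_mem hx l) (K.nsmul_mem hy k) }
  have hKD : ∀ x ∈ K, x ∈ D₀ := fun x hx => ⟨1, one_pos, by simpa⟩
  have hD₀ : ∀ x ∈ D₀, ∃ y ∈ s, 0 ≤ x y := by
    rintro x ⟨k, hk, hx⟩
    obtain ⟨y, hy, h⟩ := hK _ hx
    refine ⟨y, hy, ?_⟩
    rw [Pi.smul_apply, nsmul_eq_mul] at h
    exact nonneg_of_mul_nonneg_right h (by exact_mod_cast hk)
  have hrat : ∀ (m n : ℕ), ∀ x ∈ D₀, ((m : ℝ) / n) • x ∈ D₀ := by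
    rintro m n x ⟨k, hk, hx⟩
    rcases Nat.eq_zero_or_pos n with rfl | hn
    · simp
    refine ⟨k * n, Nat.mul_pos hk hn, ?_⟩
    have : (k * n) • ((m : ℝ) / n) • x = m • k • x := by
      ext y
      have : (n : ℝ) ≠ 0 := by positivity
      simp
      field_simp
    rw [this]
    exact K.nsmul_mem hx m
  let D := D₀.topologicalClosure
  have hDsmul : ∀ a : ℝ, 0 ≤ a → ∀ x ∈ D, a • x ∈ D := by
    intro a ha x hx
    refine map_mem_closure₂ (f := fun (a : ℝ) (x : Y → ℝ) => a • x)
      (s := Set.range fun p : ℕ × ℕ => (p.1 : ℝ) / p.2) (t := D₀) (by fun_prop)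
      ?_ hx ?_
    · refine mem_closure_of_tendsto
        ((tendsto_nat_floor_mul_div_atTop ha).comp tendsto_natCast_atTop_atTop)
        (Eventually.of_forall fun n => ⟨(⌊a * n⌋₊, n), rfl⟩)
    · rintro _ ⟨p, rfl⟩ x hx
      exact hrat _ _ x hx
  have hDconv : Convex ℝ (D : Set (Y → ℝ)) := by
    intro x hx y hy a b ha hb _
    exact D.add_mem (hDsmul a ha x hx) (hDsmul b hb y hy)
  -- Coordinates outside `s` are unconstrained in `O`; this forces the separating functional to
  -- vanish on them.
  let O : Set (Y → ℝ) := {x | ∀ y ∈ s, x y < 0}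
  have hOopen : IsOpen O := by
    have : O = ⋂ y ∈ s, {x | x y < 0} := by ext; simp [O]
    rw [this]
    exact isOpen_biInter_finset fun y _ => isOpen_lt (continuous_apply y) continuous_const
  have hOconv : Convex ℝ O := by
    intro x hx z hz a b ha hb hab y hy
    have h1 := hx y hy
    have h2 := hz y hy
    simp only [Pi.add_apply, Pi.smul_apply, smul_eq_mul]
    rcases ha.eq_or_lt with rfl | ha
    · have : b = 1 := by linarith
      subst this; linarith
    · nlinarith [mul_neg_of_pos_of_neg ha h1]
  have hdisj : Disjoint O (D : Set (Y → ℝ)) := by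
    have : Disjoint O (D₀ : Set (Y → ℝ)) := by
      refine Set.disjoint_left.2 fun x hxO hxD => ?_
      obtain ⟨y, hy, h⟩ := hD₀ x hxD
      exact absurd (hxO y hy) (not_lt.2 h)
    exact this.closure_right hOopen
  obtain ⟨f, c, hfO, hfD⟩ := geometric_hahn_banach_open hOconv hOopen hDconv hdisj
  have hc : c ≤ 0 := by simpa using hfD 0 D.zero_mem
  have hfsum : ∀ x : Y → ℝ, f x = ∑ y, f (Pi.single y 1) * x y := by
    intro x
    conv_lhs => rw [← Finset.univ_sum_single x]
    rw [map_sum]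
    refine Finset.sum_congr rfl fun y _ => ?_
    have : (Pi.single y (x y) : Y → ℝ) = x y • Pi.single y 1 := by
      ext z; simp [Pi.single_apply]
    rw [this, map_smul, smul_eq_mul, mul_comm]
  have hO : ∀ y (r : ℝ), (y ∈ s → r ≤ 0) → f (-1) + r * f (Pi.single y 1) < 0 := by
    intro y r hr
    have : (-1 : Y → ℝ) + r • Pi.single y 1 ∈ O := by
      intro z hz
      by_cases h : z = y
      · subst h; simp; linarith [hr hz]
      · simp [h]
    have := hfO _ this
    rw [map_add, map_smul, smul_eq_mul] at this
    linarith
  have hneg : f (-1) < 0 := by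
    have := hfO (-1) (fun y _ => by simp)
    linarith
  have hbound : ∀ (x z : ℝ), (∀ k : ℕ, x + k * z < 0) → z ≤ 0 := by
    intro x z h
    by_contra! hz
    obtain ⟨k, hk⟩ := exists_nat_gt (-x / z)
    rw [div_lt_iff₀ hz] at hk
    linarith [h k]
  have hnonneg : ∀ y, 0 ≤ f (Pi.single y 1) := by
    intro y
    have := hbound (f (-1)) (-f (Pi.single y 1)) fun k => by
      have := hO y (-k) (fun _ => by simp)
      linarith
    linarith
  have hzero : ∀ y ∉ s, f (Pi.single y 1) = 0 := by
    intro y hy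
    refine le_antisymm (hbound (f (-1)) _ fun k => hO y k fun h => absurd h hy) (hnonneg y)
  have hK' : ∀ x ∈ K, 0 ≤ f x := by
    intro x hx
    -- All multiples k • x lie in the cone, so c ≤ k * f x for every k; the shift by 1 makes this
    -- strict.
    have := hbound (c - 1) (- f x) fun k => by
      have h := hfD _ (D₀.le_topologicalClosure (hKD _ (K.nsmul_mem hx k)))
      rw [map_nsmul, nsmul_eq_mul] at h
      linarith
    linarith
  have hpos : 0 < ∑ y, f (Pi.single y 1) := by
    rw [hfsum] at hneg
    simpa using hneg
  refine ⟨fun y => f (Pi.single y 1) / ∑ z, f (Pi.single z 1), ⟨fun y => ?_, ?_⟩, fun y hy => ?_,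
    fun x hx => ?_⟩
  · exact div_nonneg (hnonneg y) hpos.le
  · rw [← Finset.sum_div, div_self hpos.ne']
  · simp [hzero y hy]
  · have := hK' x hx
    rw [hfsum] at this
    simp only [div_mul_eq_mul_div, ← Finset.sum_div]
    exact div_nonneg this hpos.le

/-- Multiplicative form: a monoid of nonnegative vectors, each with an entry that is at least one,
has a weighted geometric mean that is at least one on it. -/
theorem exists_stdSimplex_one_le_prod_rpow {Y : Type*} [Fintype Y] (G : Submonoid (Y → ℝ))
    (hG : ∀ p ∈ G, ∀ y, 0 ≤ p y) (hG1 : ∀ p ∈ G, ∃ y, 1 ≤ p y) :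
    ∃ μ ∈ stdSimplex ℝ Y, ∀ p ∈ G, 1 ≤ ∏ y, p y ^ μ y := by
  classical
  -- Logarithms are harmless exactly on the coordinates where no element of `G` vanishes; the
  -- measure will be supported there.
  let s : Finset Y := {y | ∀ p ∈ G, 0 < p y}
  obtain ⟨p₀, hp₀, hp₀s⟩ : ∃ p ∈ G, ∀ y ∉ s, p y = 0 := by
    have : ∀ y, ∃ p ∈ G, y ∉ s → p y = 0 := by
      intro y
      by_cases hy : y ∈ s
      · exact ⟨1, G.one_mem, fun h => absurd hy h⟩
      · have : ∃ p ∈ G, p y ≤ 0 := by simpa [s] using hy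
        obtain ⟨p, hp, h⟩ := this
        exact ⟨p, hp, fun _ => le_antisymm h (hG p hp y)⟩
    choose p hp hp0 using this
    refine ⟨∏ y, p y, G.prod_mem fun y _ => hp y, fun y hy => ?_⟩
    rw [Finset.prod_apply]
    exact Finset.prod_eq_zero (Finset.mem_univ y) (hp0 y hy)
  -- If p were below 1 on all of `s`, then p ^ k * p₀ would be below 1 on `s` for large k and zero
  -- elsewhere, contradicting `hG1`.
  have hs : ∀ p ∈ G, ∃ y ∈ s, 1 ≤ p y := by
    intro p hp
    by_contra! h
    have hlim : ∀ᶠ k : ℕ in atTop, ∀ y ∈ s, p y ^ k * p₀ y < 1 := by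
      rw [Filter.eventually_all_finset]
      intro y hy
      have := (tendsto_pow_atTop_nhds_zero_of_lt_one (hG p hp y) (h y hy)).mul_const (p₀ y)
      rw [zero_mul] at this
      exact this.eventually_lt_const one_pos
    obtain ⟨k, hk⟩ := hlim.exists
    obtain ⟨y, hy⟩ := hG1 _ (G.mul_mem (G.pow_mem hp k) hp₀)
    simp only [Pi.mul_apply, Pi.pow_apply] at hy
    by_cases hys : y ∈ s
    · linarith [hk y hys]
    · rw [hp₀s y hys, mul_zero] at hy
      linarith
  have hspos : ∀ p ∈ G, ∀ y ∈ s, 0 < p y := by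
    intro p hp y hy
    simp only [s, Finset.mem_filter] at hy
    exact hy.2 p hp
  let K : AddSubmonoid (Y → ℝ) :=
    { carrier := {x | ∃ p ∈ G, ∀ y ∈ s, x y = Real.log (p y)}
      zero_mem' := ⟨1, G.one_mem, by simp⟩
      add_mem' := by
        rintro x z ⟨p, hp, hx⟩ ⟨q, hq, hz⟩
        refine ⟨p * q, G.mul_mem hp hq, fun y hy => ?_⟩
        rw [Pi.add_apply, hx y hy, hz y hy, Pi.mul_apply,
          Real.log_mul (hspos p hp y hy).ne' (hspos q hq y hy).ne'] }
  obtain ⟨μ, hμ, hμs, hμK⟩ := exists_stdSimplex_nonneg_of_addSubmonoid s K (by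
    rintro x ⟨p, hp, hx⟩
    obtain ⟨y, hy, h⟩ := hs p hp
    exact ⟨y, hy, by rw [hx y hy]; exact Real.log_nonneg h⟩)
  refine ⟨μ, hμ, fun p hp => ?_⟩
  have h := hμK (fun y => Real.log (p y)) ⟨p, hp, fun _ _ => rfl⟩
  have hprod : ∏ y, p y ^ μ y = Real.exp (∑ y, μ y * Real.log (p y)) := by
    rw [Real.exp_sum]
    refine Finset.prod_congr rfl fun y _ => ?_
    by_cases hy : y ∈ s
    · rw [Real.rpow_def_of_pos (hspos p hp y hy), mul_comm]
    · simp [hμs y hy]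
  rw [hprod]
  exact Real.one_le_exp h

/-- If every tensor power of `S` is, at every vector, dominated by the maximum of the tensor powers
of the `P y`, then it is dominated by a fixed weighted geometric mean. -/
theorem exists_stdSimplex_quadForm_le_prod {ι Y : Type*} [Fintype ι] [Fintype Y]
    {S : Matrix ι ι ℂ} {P : Y → Matrix ι ι ℂ} (hS : S.PosSemidef) (hP : ∀ y, (P y).PosSemidef)
    (h : ∀ n w, ∃ y, quadForm (matTensorPow n S) w ≤ quadForm (matTensorPow n (P y)) w) :
    ∃ μ ∈ stdSimplex ℝ Y, ∀ n w,
      quadForm (matTensorPow n S) w ≤ ∏ y, quadForm (matTensorPow n (P y)) w ^ μ y := by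
  classical
  have hPn n w y := ((hP y).matTensorPow n).quadForm_nonneg w
  let G : Submonoid (Y → ℝ) :=
    { carrier := {p | ∃ n w, 0 < quadForm (matTensorPow n S) w ∧
        ∀ y, p y = quadForm (matTensorPow n (P y)) w / quadForm (matTensorPow n S) w}
      one_mem' := by
        refine ⟨0, fun _ => 1, ?_, fun y => ?_⟩ <;> simp [quadForm, Matrix.mulVec, dotProduct]
      mul_mem' := by
        rintro p q ⟨m, v, hv, hp⟩ ⟨n, w, hw, hq⟩
        refine ⟨m + n, fun a => v (fun i => a (Fin.castAdd n i)) * w fun i => a (Fin.natAdd m i),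
          ?_, fun y => ?_⟩
        · rw [quadForm_matTensorPow_append hS.1]
          positivity
        · rw [quadForm_matTensorPow_append hS.1, quadForm_matTensorPow_append (hP y).1,
            Pi.mul_apply, hp, hq, div_mul_div_comm] }
  obtain ⟨μ, hμ, hμG⟩ := exists_stdSimplex_one_le_prod_rpow G
    (by
      rintro p ⟨n, w, hw, hp⟩ y
      rw [hp y]
      exact div_nonneg (hPn n w y) hw.le)
    (by
      rintro p ⟨n, w, hw, hp⟩
      obtain ⟨y, hy⟩ := h n w
      exact ⟨y, by rwa [hp y, one_le_div hw]⟩)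
  refine ⟨μ, hμ, fun n w => ?_⟩
  -- Vectors on which the form of `S` vanishes give no ratio, but for them the bound is trivial.
  rcases ((hS.matTensorPow n).quadForm_nonneg w).eq_or_lt with h0 | hpos
  · rw [← h0]
    exact Finset.prod_nonneg fun y _ => Real.rpow_nonneg (hPn n w y) _
  · have := hμG _ ⟨n, w, hpos, fun y => rfl⟩
    simp only [Real.div_rpow (hPn n w _) hpos.le, Finset.prod_div_distrib] at this
    rw [← Real.rpow_sum_of_pos hpos, hμ.2, Real.rpow_one, one_le_div hpos] at this
    exact this

/-! ### The geometric mean of positive definite matrices -/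

section GeomMean

variable {ι : Type u} [Fintype ι] [DecidableEq ι]

/-- Powers of a positive definite matrix in terms of its diagonalization. -/
theorem Matrix.PosDef.exists_rpow_eq {X : Matrix ι ι ℂ} (hX : X.PosDef) :
    ∃ (U : Matrix ι ι ℂ) (d : ι → ℝ), U * U.conjTranspose = 1 ∧ U.conjTranspose * U = 1 ∧
      (∀ i, 0 < d i) ∧ ∀ t : ℝ,
        X ^ t = U * Matrix.diagonal (fun i => ((d i ^ t : ℝ) : ℂ)) * U.conjTranspose := by
  refine ⟨hX.1.eigenvectorUnitary, hX.1.eigenvalues,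
    Unitary.coe_mul_star_self hX.1.eigenvectorUnitary,
    Unitary.coe_star_mul_self hX.1.eigenvectorUnitary, hX.eigenvalues_pos, fun t => ?_⟩
  rw [CFC.rpow_def, cfc_nnreal_eq_real _ X hX.posSemidef.nonneg, hX.1.cfc_eq,
    Matrix.IsHermitian.cfc, Unitary.conjStarAlgAut_apply]
  have : (RCLike.ofReal ∘ (fun x : ℝ => ((x.toNNReal ^ t : NNReal) : ℝ)) ∘
      hX.1.eigenvalues : ι → ℂ) = fun i => ((hX.1.eigenvalues i ^ t : ℝ) : ℂ) := by
    ext i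
    simp [max_eq_left (hX.eigenvalues_pos i).le]
  rw [this]
  rfl

/-- Two positive definite matrices are simultaneously diagonalized by a congruence, and then so are
all their geometric means. -/
theorem exists_geomMeanPosDef_eq {Q P : Matrix ι ι ℂ} (hQ : Q.PosDef) (hP : P.PosDef) :
    ∃ (L M : Matrix ι ι ℂ) (d : ι → ℝ), L * M = 1 ∧ M * L = 1 ∧ (∀ i, 0 < d i) ∧
      Q = L * L.conjTranspose ∧
      P = L * Matrix.diagonal (fun i => (d i : ℂ)) * L.conjTranspose ∧
      ∀ t : ℝ, geomMeanPosDef t Q P =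
        L * Matrix.diagonal (fun i => ((d i ^ t : ℝ) : ℂ)) * L.conjTranspose := by
  have hQs := hQ.isStrictlyPositive
  set R := Q ^ (1 / 2 : ℝ) with hR
  set R' := Q ^ (-1 / 2 : ℝ) with hR'
  have hRR' : R * R' = 1 := by
    rw [hR, hR', neg_div]; exact CFC.rpow_mul_rpow_neg _ hQs
  have hR'R : R' * R = 1 := by
    rw [hR, hR', neg_div]; exact CFC.rpow_neg_mul_rpow _ hQs
  have hRR : R * R = Q := by
    rw [hR, ← CFC.rpow_add hQs.isUnit, add_halves, CFC.rpow_one Q hQs.nonneg]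
  have hRh : R.conjTranspose = R := (Matrix.nonneg_iff_posSemidef.1 (CFC.rpow_nonneg (a := Q))).1
  have hR'h : R'.conjTranspose = R' := (Matrix.nonneg_iff_posSemidef.1 (CFC.rpow_nonneg (a := Q))).1
  have hX : (R' * P * R').PosDef := by
    have h : (R' * P * R').PosSemidef := by
      simpa only [hR'h] using hP.posSemidef.mul_mul_conjTranspose_same R'
    have hu : IsUnit R' := ⟨⟨R', R, hR'R, hRR'⟩, rfl⟩
    exact h.posDef_iff_isUnit.2 ((hu.mul hP.isUnit).mul hu)
  obtain ⟨U, d, hUU, hUU', hd, hpow⟩ := hX.exists_rpow_eq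
  -- The congruence is L = Q^{1/2} U, with U diagonalizing Q^{-1/2} P Q^{-1/2}.
  refine ⟨R * U, U.conjTranspose * R', d, ?_, ?_, hd, ?_, ?_, fun t => ?_⟩
  · rw [Matrix.mul_assoc, ← Matrix.mul_assoc U, hUU, Matrix.one_mul, hRR']
  · rw [Matrix.mul_assoc, ← Matrix.mul_assoc R', hR'R, Matrix.one_mul, hUU']
  · rw [Matrix.conjTranspose_mul, hRh, Matrix.mul_assoc, ← Matrix.mul_assoc U, hUU,
      Matrix.one_mul, hRR]
  · have h1 := hpow 1
    rw [CFC.rpow_one _ hX.posSemidef.nonneg] at h1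
    simp only [Real.rpow_one] at h1
    calc P = (R * R') * P * (R' * R) := by rw [hRR', hR'R]; simp
      _ = R * (R' * P * R') * R := by simp only [Matrix.mul_assoc]
      _ = _ := by rw [h1, Matrix.conjTranspose_mul, hRh]; simp only [Matrix.mul_assoc]
  · rw [geomMeanPosDef, ← hR, ← hR', hpow, Matrix.conjTranspose_mul, hRh]
    simp only [Matrix.mul_assoc]

theorem geomMeanPosDef_posSemidef {Q P : Matrix ι ι ℂ} (hQ : Q.PosDef) (hP : P.PosDef) (t : ℝ) :
    (geomMeanPosDef t Q P).PosSemidef := by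
  obtain ⟨L, M, d, -, -, hd, -, -, h⟩ := exists_geomMeanPosDef_eq hQ hP
  rw [h]
  refine Matrix.PosSemidef.mul_mul_conjTranspose_same ?_ L
  refine Matrix.PosSemidef.diagonal fun i => ?_
  exact Complex.zero_le_real.2 (Real.rpow_nonneg (hd i).le t)

/-- Hölder's inequality with exponents 1/(1 − t) and 1/t. Summing the weighted arithmetic-geometric
inequality for the normalized terms treats the endpoints t = 0, 1 uniformly. -/
theorem sum_rpow_mul_rpow_le {κ : Type*} (s : Finset κ) {x y : κ → ℝ} (hx : ∀ i, 0 ≤ x i)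
    (hy : ∀ i, 0 ≤ y i) {t : ℝ} (ht : t ∈ Set.Icc (0 : ℝ) 1) (hX : 0 < ∑ i ∈ s, x i)
    (hZ : 0 < ∑ i ∈ s, y i) :
    ∑ i ∈ s, x i ^ (1 - t) * y i ^ t ≤ (∑ i ∈ s, x i) ^ (1 - t) * (∑ i ∈ s, y i) ^ t := by
  set X := ∑ i ∈ s, x i
  set Z := ∑ i ∈ s, y i
  have key : ∀ i, x i ^ (1 - t) * y i ^ t ≤
      X ^ (1 - t) * Z ^ t * ((1 - t) * (x i / X) + t * (y i / Z)) := by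
    intro i
    have h := Real.geom_mean_le_arith_mean2_weighted (sub_nonneg.2 ht.2) ht.1
      (div_nonneg (hx i) hX.le) (div_nonneg (hy i) hZ.le) (by ring)
    rw [Real.div_rpow (hx i) hX.le, Real.div_rpow (hy i) hZ.le, div_mul_div_comm,
      div_le_iff₀ (by positivity)] at h
    linarith
  calc _ ≤ ∑ i ∈ s, X ^ (1 - t) * Z ^ t * ((1 - t) * (x i / X) + t * (y i / Z)) :=
        Finset.sum_le_sum fun i _ => key i
    _ = X ^ (1 - t) * Z ^ t * ((1 - t) * (X / X) + t * (Z / Z)) := by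
        rw [← Finset.mul_sum, Finset.sum_add_distrib, ← Finset.mul_sum, ← Finset.mul_sum,
          ← Finset.sum_div, ← Finset.sum_div]
    _ = _ := by rw [div_self hX.ne', div_self hZ.ne']; ring

/-- After the simultaneous congruence all three tensor powers are diagonal in the product basis, and
the bound is Hölder's inequality for the weights |v a|² and ∏ d (a i) |v a|². -/
theorem quadForm_geomMeanPosDef_le {Q P : Matrix ι ι ℂ} (hQ : Q.PosDef) (hP : P.PosDef) {t : ℝ}
    (ht : t ∈ Set.Icc (0 : ℝ) 1) (n : ℕ) (w : (Fin n → ι) → ℂ) :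
    quadForm (matTensorPow n (geomMeanPosDef t Q P)) w ≤
      quadForm (matTensorPow n Q) w ^ (1 - t) * quadForm (matTensorPow n P) w ^ t := by
  obtain ⟨L, M, d, -, -, hd, rfl, rfl, h⟩ := exists_geomMeanPosDef_eq hQ hP
  have hL := quadForm_matTensorPow_conj n L 1 w
  rw [Matrix.mul_one] at hL
  rw [h, hL, quadForm_matTensorPow_conj, quadForm_matTensorPow_conj, matTensorPow_one]
  generalize (matTensorPow n L).conjTranspose.mulVec w = v
  have hdiag : ∀ e : ι → ℝ, matTensorPow n (Matrix.diagonal fun i => (e i : ℂ)) =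
      Matrix.diagonal fun a => ((∏ i, e (a i) : ℝ) : ℂ) := by
    intro e; rw [matTensorPow_diagonal]; simp
  rw [hdiag, hdiag, quadForm_diagonal, quadForm_diagonal, quadForm_one]
  have hdp : ∀ a : Fin n → ι, 0 < ∏ i, d (a i) := fun a => Finset.prod_pos fun i _ => hd _
  by_cases hv : v = 0
  · subst hv; simp; positivity
  obtain ⟨a₀, ha₀⟩ := Function.ne_iff.1 hv
  refine le_trans (le_of_eq ?_) (sum_rpow_mul_rpow_le Finset.univ
    (x := fun a => Complex.normSq (v a)) (y := fun a => (∏ i, d (a i)) * Complex.normSq (v a))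
    (fun a => Complex.normSq_nonneg _) (fun a => mul_nonneg (hdp a).le (Complex.normSq_nonneg _))
    ht ?_ ?_)
  · refine Finset.sum_congr rfl fun a _ => ?_
    rw [Real.mul_rpow (hdp a).le (Complex.normSq_nonneg _),
      ← Real.finsetProd_rpow _ _ fun i _ => (hd _).le, mul_left_comm]
    congr 1
    -- Since 0 ^ 0 = 1 for real powers, a zero weight needs a case split on t.
    rcases (Complex.normSq_nonneg (v a)).eq_or_lt with h0 | h0
    · rw [← h0]
      rcases eq_or_ne t 0 with rfl | h1
      · simp
      · rw [Real.zero_rpow h1, mul_zero]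
    · rw [← Real.rpow_add h0, sub_add_cancel, Real.rpow_one]
  · exact Finset.sum_pos' (fun a _ => Complex.normSq_nonneg _)
      ⟨a₀, Finset.mem_univ _, Complex.normSq_pos.2 ha₀⟩
  · exact Finset.sum_pos' (fun a _ => mul_nonneg (hdp a).le (Complex.normSq_nonneg _))
      ⟨a₀, Finset.mem_univ _, mul_pos (hdp a₀) (Complex.normSq_pos.2 ha₀)⟩

/-- Polynomial factors do not affect exponential growth rates. -/
theorem le_of_pow_le_poly_mul_pow {s g : ℝ} (hg : 0 ≤ g) (k : ℕ)
    (h : ∀ n : ℕ, s ^ n ≤ ((n : ℝ) + 1) ^ k * g ^ n) : s ≤ g := by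
  by_contra! hlt
  rcases hg.eq_or_lt with rfl | hg
  · have := h 1
    simp at this
    linarith
  have hr : 1 < s / g := by rwa [one_lt_div hg]
  have hlim := tendsto_pow_const_div_const_pow_of_one_lt k hr
  -- The index shift produces (n + 1) ^ k, and the factor s / g restores the exponent n in the
  -- denominator.
  have hlim2 := (hlim.comp (tendsto_add_atTop_nat 1)).const_mul (s / g)
  rw [mul_zero] at hlim2
  obtain ⟨n, hn⟩ := (hlim2.eventually_lt_const one_pos).exists
  have hsg : 0 < s / g := by positivity
  have hn' : ((n : ℝ) + 1) ^ k < (s / g) ^ n := by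
    simp only [Function.comp, Nat.cast_add, Nat.cast_one, pow_succ] at hn
    rw [mul_div_assoc', mul_comm, mul_div_mul_right _ _ hsg.ne', div_lt_one (by positivity)] at hn
    exact hn
  rw [div_pow, lt_div_iff₀ (by positivity)] at hn'
  linarith [h n]

/-- Pinching argument: an asymptotic geometric-mean bound with respect to the identity and a
diagonal matrix is a bound by the corresponding power of that diagonal matrix. -/
theorem posSemidef_diagonal_rpow_sub {S : Matrix ι ι ℂ} (hS : S.PosSemidef) {d : ι → ℝ}
    (hd : ∀ i, 0 < d i) {t : ℝ}
    (h : ∀ n w, quadForm (matTensorPow n S) w ≤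
      quadForm (matTensorPow n (1 : Matrix ι ι ℂ)) w ^ (1 - t) *
        quadForm (matTensorPow n (Matrix.diagonal fun i => (d i : ℂ))) w ^ t) :
    (Matrix.diagonal (fun i => ((d i ^ t : ℝ) : ℂ)) - S).PosSemidef := by
  refine posSemidef_sub_of_quadForm_le hS.1
    (Matrix.isHermitian_diagonal_of_self_adjoint _ (by ext; simp)) fun u => ?_
  rw [quadForm_diagonal]
  have hg : 0 ≤ ∑ i, d i ^ t * Complex.normSq (u i) := Finset.sum_nonneg fun i _ =>
    mul_nonneg (Real.rpow_nonneg (hd i).le _) (Complex.normSq_nonneg _)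
  refine le_of_pow_le_poly_mul_pow hg (Fintype.card ι) fun n => ?_
  let v : (Fin n → ι) → ℂ := fun a => ∏ i, u (a i)
  -- The type of a word: how often each letter occurs. The eigenvalue ∏ d (a i) depends only on it,
  -- and there are at most (n + 1) ^ card ι types.
  let τ : (Fin n → ι) → (ι → Fin (n + 1)) := fun a j =>
    ⟨(Finset.univ.filter fun i => a i = j).card, by
      have := Finset.card_le_univ (Finset.univ.filter fun i => a i = j)
      rw [Fintype.card_fin] at this
      omega⟩
  let D : (ι → Fin (n + 1)) → ℝ := fun k => ∏ j, d j ^ (k j : ℕ)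
  have hD : ∀ k, 0 < D k := fun k => Finset.prod_pos fun j _ => pow_pos (hd j) _
  have hDτ : ∀ a, ∏ i, d (a i) = D (τ a) := by
    intro a
    simp only [D, τ]
    rw [← Finset.prod_fiberwise_of_maps_to (fun i _ => Finset.mem_univ (a i)) fun i => d (a i)]
    refine Finset.prod_congr rfl fun j _ => ?_
    rw [Finset.prod_congr rfl (g := fun _ => d j) fun i hi => by
      rw [(Finset.mem_filter.1 hi).2], Finset.prod_const]
  let vk : (ι → Fin (n + 1)) → (Fin n → ι) → ℂ := fun k a => if τ a = k then v a else 0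
  have hv : v = ∑ k, vk k := by
    ext a
    simp [vk, Finset.sum_apply]
  -- On a single type class the diagonal tensor power is the scalar `D k`, so the geometric-mean
  -- bound collapses to `D k ^ t` times the squared norm.
  have hvk : ∀ k, quadForm (matTensorPow n S) (vk k) ≤
      ∑ a, if τ a = k then D (τ a) ^ t * Complex.normSq (v a) else 0 := by
    intro k
    refine (h n (vk k)).trans (le_of_eq ?_)
    have hdiag : matTensorPow n (Matrix.diagonal fun i => (d i : ℂ)) =
        Matrix.diagonal fun a => ((D (τ a) : ℝ) : ℂ) := by
      rw [matTensorPow_diagonal]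
      congr 1; ext a
      rw [← hDτ]; simp
    rw [matTensorPow_one, quadForm_one, hdiag, quadForm_diagonal]
    have h1 : ∑ a, D (τ a) * Complex.normSq (vk k a) = D k * ∑ a, Complex.normSq (vk k a) := by
      rw [Finset.mul_sum]
      refine Finset.sum_congr rfl fun a _ => ?_
      by_cases ha : τ a = k
      · rw [ha]
      · simp [vk, ha]
    have h2 : (∑ a, if τ a = k then D (τ a) ^ t * Complex.normSq (v a) else 0) =
        D k ^ t * ∑ a, Complex.normSq (vk k a) := by
      rw [Finset.mul_sum]
      refine Finset.sum_congr rfl fun a _ => ?_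
      by_cases ha : τ a = k
      · simp [vk, ha]
      · simp [vk, ha]
    have h3 : 0 ≤ ∑ a, Complex.normSq (vk k a) :=
      Finset.sum_nonneg fun a _ => Complex.normSq_nonneg _
    rw [h1, h2, Real.mul_rpow (hD k).le h3]
    rcases h3.eq_or_lt with h0 | h0
    · rw [← h0]
      rcases eq_or_ne t 0 with rfl | h1
      · simp
      · rw [Real.zero_rpow h1]; simp
    · rw [mul_left_comm, ← Real.rpow_add h0, sub_add_cancel, Real.rpow_one]
  have hcard : ((Finset.univ : Finset (ι → Fin (n + 1))).card : ℝ) =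
      ((n : ℝ) + 1) ^ Fintype.card ι := by
    rw [Finset.card_univ, Fintype.card_fun, Fintype.card_fin]; push_cast; rfl
  calc quadForm S u ^ n = quadForm (matTensorPow n S) (∑ k, vk k) := by
        rw [← hv, quadForm_matTensorPow_prod hS.1]
    _ ≤ ((n : ℝ) + 1) ^ Fintype.card ι * ∑ k, quadForm (matTensorPow n S) (vk k) := by
        rw [← hcard]; exact quadForm_sum_le (hS.matTensorPow n) _ _
    _ ≤ ((n : ℝ) + 1) ^ Fintype.card ι *
          ∑ k, ∑ a, (if τ a = k then D (τ a) ^ t * Complex.normSq (v a) else 0) := by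
        gcongr with k; exact hvk k
    _ = ((n : ℝ) + 1) ^ Fintype.card ι * (∑ i, d i ^ t * Complex.normSq (u i)) ^ n := by
        congr 1
        rw [Finset.sum_comm, ← Fin.prod_const, Finset.prod_univ_sum, Fintype.piFinset_univ]
        refine Finset.sum_congr rfl fun a _ => ?_
        rw [Finset.sum_ite_eq, if_pos (Finset.mem_univ _), ← hDτ, Finset.prod_mul_distrib,
          Real.finsetProd_rpow _ _ fun i _ => (hd _).le, ← map_prod]

/-- The geometric mean is the largest positive semidefinite matrix that satisfies the asymptotic
geometric-mean bound. -/
theorem posSemidef_geomMeanPosDef_sub {Q P S : Matrix ι ι ℂ} (hQ : Q.PosDef) (hP : P.PosDef)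
    (hS : S.PosSemidef) {t : ℝ}
    (h : ∀ n w, quadForm (matTensorPow n S) w ≤
      quadForm (matTensorPow n Q) w ^ (1 - t) * quadForm (matTensorPow n P) w ^ t) :
    (geomMeanPosDef t Q P - S).PosSemidef := by
  obtain ⟨L, M, d, hLM, hML, hd, hQL, hPL, hG⟩ := exists_geomMeanPosDef_eq hQ hP
  have hLM' : M.conjTranspose * L.conjTranspose = 1 := by
    rw [← Matrix.conjTranspose_mul, hLM, Matrix.conjTranspose_one]
  have hML' : L.conjTranspose * M.conjTranspose = 1 := by
    rw [← Matrix.conjTranspose_mul, hML, Matrix.conjTranspose_one]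
  have hcancel : ∀ C : Matrix ι ι ℂ, M * (L * C * L.conjTranspose) * M.conjTranspose = C := by
    intro C
    calc M * (L * C * L.conjTranspose) * M.conjTranspose
        = (M * L) * C * (L.conjTranspose * M.conjTranspose) := by simp only [Matrix.mul_assoc]
      _ = C := by rw [hML, hML']; simp
  have hcancel' : L * (M * S * M.conjTranspose) * L.conjTranspose = S := by
    calc L * (M * S * M.conjTranspose) * L.conjTranspose
        = (L * M) * S * (M.conjTranspose * L.conjTranspose) := by simp only [Matrix.mul_assoc]
      _ = S := by rw [hLM, hLM']; simp
  have hQ1 : M * Q * M.conjTranspose = 1 := by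
    have := hcancel 1
    rwa [Matrix.mul_one, ← hQL] at this
  have hP1 := hcancel (Matrix.diagonal fun i => (d i : ℂ))
  rw [← hPL] at hP1
  -- The hypothesis is invariant under congruence because it is assumed for every w; conjugating by
  -- M = L⁻¹ reduces to the pair of the identity and a diagonal matrix.
  have key := posSemidef_diagonal_rpow_sub (hS.mul_mul_conjTranspose_same M) hd (t := t)
    fun n w => by
      rw [← hQ1, ← hP1]
      simp only [quadForm_matTensorPow_conj]
      exact h n _
  have := key.mul_mul_conjTranspose_same L
  rwa [Matrix.mul_sub, Matrix.sub_mul, hcancel', ← hG] at this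

/-- The mean of the smaller pair satisfies the asymptotic bound of that pair, hence that of the
larger pair, whose mean is maximal. -/
theorem geomMeanPosDef_mono {Q P Q' P' : Matrix ι ι ℂ} (hQ : Q.PosDef) (hP : P.PosDef)
    (hQ' : (Q' - Q).PosSemidef) (hP' : (P' - P).PosSemidef) {t : ℝ}
    (ht : t ∈ Set.Icc (0 : ℝ) 1) :
    (geomMeanPosDef t Q' P' - geomMeanPosDef t Q P).PosSemidef := by
  have hQd : Q'.PosDef := by simpa using hQ.add_posSemidef hQ'
  have hPd : P'.PosDef := by simpa using hP.add_posSemidef hP'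
  refine posSemidef_geomMeanPosDef_sub hQd hPd (geomMeanPosDef_posSemidef hQ hP t) fun n w => ?_
  refine (quadForm_geomMeanPosDef_le hQ hP ht n w).trans ?_
  have hQn := (hQ.posSemidef.matTensorPow n).quadForm_nonneg w
  have hPn := (hP.posSemidef.matTensorPow n).quadForm_nonneg w
  have h1 := quadForm_le_of_posSemidef_sub (matTensorPow_sub_posSemidef hQ.posSemidef hQ' n) w
  have h2 := quadForm_le_of_posSemidef_sub (matTensorPow_sub_posSemidef hP.posSemidef hP' n) w
  exact mul_le_mul (Real.rpow_le_rpow hQn h1 (sub_nonneg.2 ht.2)) (Real.rpow_le_rpow hPn h2 ht.1)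
    (Real.rpow_nonneg hPn _) (Real.rpow_nonneg (hQn.trans h1) _)

end GeomMean

/-! ### The limit ε ↘ 0 for positive semidefinite matrices -/

section KuboAndo

variable {ι : Type u}

theorem dotProduct_mulVec_single_add [Fintype ι] [DecidableEq ι] (C : Matrix ι ι ℂ)
    (i j : ι) (c : ℂ) :
    star (Pi.single i 1 + c • Pi.single j 1 : ι → ℂ) ⬝ᵥ
        C.mulVec (Pi.single i 1 + c • Pi.single j 1) =
      C i i + c * C i j + star c * C j i + star c * c * C j j := by
  have hs : ∀ k : ι, star (Pi.single k 1 : ι → ℂ) = Pi.single k 1 := by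
    intro k; ext l; by_cases h : l = k
    · subst h; simp
    · simp [h]
  simp only [star_add, star_smul, hs, Matrix.mulVec_add, Matrix.mulVec_smul, add_dotProduct,
    dotProduct_add, smul_dotProduct, dotProduct_smul, single_dotProduct, Matrix.mulVec_single,
    Matrix.col_apply, MulOpposite.op_one, one_smul, one_mul, smul_eq_mul]
  ring

/-- Polarization; it turns convergence of quadratic forms into convergence of entries. -/
theorem Matrix.IsHermitian.apply_eq_sum_quadForm [Fintype ι] [DecidableEq ι]
    {C : Matrix ι ι ℂ} (hC : C.IsHermitian)
    (i j : ι) :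
    C i j = (quadForm C (Pi.single i 1 + (1 : ℂ) • Pi.single j 1)
      - quadForm C (Pi.single i 1 + (-1 : ℂ) • Pi.single j 1)
      - Complex.I * quadForm C (Pi.single i 1 + Complex.I • Pi.single j 1)
      + Complex.I * quadForm C (Pi.single i 1 + (-Complex.I) • Pi.single j 1)) / 4 := by
  simp only [← hC.dotProduct_mulVec_eq, dotProduct_mulVec_single_add]
  have hI : star Complex.I = -Complex.I := Complex.conj_I
  simp only [star_neg, star_one, hI]
  ring_nf
  simp only [Complex.I_sq]
  ring

theorem tendsto_of_tendsto_quadForm {σ : Type*} [Fintype ι] {l : Filter σ} {f : σ → Matrix ι ι ℂ}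
    (hf : ∀ᶠ s in l, (f s).IsHermitian)
    (h : ∀ v, ∃ r, Tendsto (fun s => quadForm (f s) v) l (𝓝 r)) :
    ∃ G, Tendsto f l (𝓝 G) := by
  classical
  choose r hr using h
  have hc : ∀ v, Tendsto (fun s => (quadForm (f s) v : ℂ)) l (𝓝 (r v : ℂ)) := fun v =>
    (Complex.continuous_ofReal.tendsto _).comp (hr v)
  have : ∀ i j, ∃ g, Tendsto (fun s => f s i j) l (𝓝 g) := by
    intro i j
    let e : ℂ → ι → ℂ := fun c => Pi.single i 1 + c • Pi.single j 1
    refine ⟨_, (((((hc (e 1)).sub (hc (e (-1)))).sub ((hc (e Complex.I)).const_mul Complex.I)).add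
      ((hc (e (-Complex.I))).const_mul Complex.I)).div_const 4).congr' ?_⟩
    filter_upwards [hf] with s hs
    exact (hs.apply_eq_sum_quadForm i j).symm
  choose g hg using this
  exact ⟨Matrix.of g, tendsto_pi_nhds.2 fun i => tendsto_pi_nhds.2 fun j => hg i j⟩

theorem posSemidef_of_tendsto {σ : Type*} [Fintype ι] {l : Filter σ} [l.NeBot]
    {f : σ → Matrix ι ι ℂ}
    {G : Matrix ι ι ℂ} (hf : ∀ᶠ s in l, (f s).PosSemidef) (h : Tendsto f l (𝓝 G)) :
    G.PosSemidef := by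
  have hG : G.IsHermitian := by
    have h1 : Tendsto (fun s => (f s).conjTranspose) l (𝓝 G.conjTranspose) :=
      (continuous_id.matrix_conjTranspose.tendsto G).comp h
    refine tendsto_nhds_unique (h1.congr' ?_) h
    filter_upwards [hf] with s hs using hs.1
  refine posSemidef_of_quadForm_nonneg hG fun v => ?_
  refine ge_of_tendsto (((continuous_quadForm v).tendsto G).comp h) ?_
  filter_upwards [hf] with s hs using hs.quadForm_nonneg v

theorem Matrix.PosSemidef.add_smul_one_posDef [DecidableEq ι]
    {P : Matrix ι ι ℂ} (hP : P.PosSemidef) {ε : ℝ}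
    (hε : 0 < ε) : (P + (ε : ℂ) • 1).PosDef :=
  Matrix.PosDef.posSemidef_add hP (Matrix.PosDef.one.smul (Complex.zero_lt_real.2 hε))

theorem posSemidef_add_smul_one_sub [DecidableEq ι] {P : Matrix ι ι ℂ} {ε δ : ℝ} (h : ε ≤ δ) :
    ((P + (δ : ℂ) • 1) - (P + (ε : ℂ) • 1)).PosSemidef := by
  have : (P + (δ : ℂ) • 1) - (P + (ε : ℂ) • 1) = ((δ - ε : ℝ) : ℂ) • 1 := by
    rw [add_sub_add_left_eq_sub, ← sub_smul, Complex.ofReal_sub]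
  rw [this]
  exact Matrix.PosSemidef.one.smul (Complex.zero_le_real.2 (sub_nonneg.2 h))

variable [Fintype ι] [DecidableEq ι]

/-- The regularized means decrease as ε does and stay positive semidefinite, so each quadratic form
converges. -/
theorem exists_isKuboAndoMean {Q P : Matrix ι ι ℂ} (hQ : Q.PosSemidef) (hP : P.PosSemidef) {t : ℝ}
    (ht : t ∈ Set.Icc (0 : ℝ) 1) : ∃ G, IsKuboAndoMean t Q P G := by
  refine tendsto_of_tendsto_quadForm ?_ fun v => ?_
  · filter_upwards [self_mem_nhdsWithin] with ε hε
    exact (geomMeanPosDef_posSemidef (hQ.add_smul_one_posDef hε) (hP.add_smul_one_posDef hε) t).1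
  · refine ⟨_, MonotoneOn.tendsto_nhdsGT ?_ ?_⟩
    · intro ε hε δ hδ h
      exact quadForm_le_of_posSemidef_sub (geomMeanPosDef_mono (hQ.add_smul_one_posDef hε)
        (hP.add_smul_one_posDef hε) (posSemidef_add_smul_one_sub h)
        (posSemidef_add_smul_one_sub h) ht) v
    · refine ⟨0, ?_⟩
      rintro _ ⟨ε, hε, rfl⟩
      exact (geomMeanPosDef_posSemidef (hQ.add_smul_one_posDef hε)
        (hP.add_smul_one_posDef hε) t).quadForm_nonneg v

theorem quadForm_matTensorPow_le_add_smul_one {P : Matrix ι ι ℂ} (hP : P.PosSemidef) {ε : ℝ}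
    (hε : 0 < ε) (n : ℕ) (w : (Fin n → ι) → ℂ) :
    quadForm (matTensorPow n P) w ≤ quadForm (matTensorPow n (P + (ε : ℂ) • 1)) w := by
  refine quadForm_le_of_posSemidef_sub (matTensorPow_sub_posSemidef hP ?_ n) w
  simpa using posSemidef_add_smul_one_sub (P := P) hε.le

theorem exists_isKuboAndoMean_of_quadForm_le {Q P S : Matrix ι ι ℂ} (hQ : Q.PosSemidef)
    (hP : P.PosSemidef) (hS : S.PosSemidef) {t : ℝ} (ht : t ∈ Set.Icc (0 : ℝ) 1)
    (h : ∀ n w, quadForm (matTensorPow n S) w ≤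
      quadForm (matTensorPow n Q) w ^ (1 - t) * quadForm (matTensorPow n P) w ^ t) :
    ∃ G, IsKuboAndoMean t Q P G ∧ (G - S).PosSemidef := by
  obtain ⟨G, hG⟩ := exists_isKuboAndoMean hQ hP ht
  refine ⟨G, hG, posSemidef_of_tendsto ?_ (hG.sub_const S)⟩
  filter_upwards [self_mem_nhdsWithin] with ε hε
  refine posSemidef_geomMeanPosDef_sub (hQ.add_smul_one_posDef hε) (hP.add_smul_one_posDef hε) hS
    fun n w => (h n w).trans ?_
  have hQn := (hQ.matTensorPow n).quadForm_nonneg w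
  have hPn := (hP.matTensorPow n).quadForm_nonneg w
  have h1 := quadForm_matTensorPow_le_add_smul_one hQ hε n w
  have h2 := quadForm_matTensorPow_le_add_smul_one hP hε n w
  exact mul_le_mul (Real.rpow_le_rpow hQn h1 (sub_nonneg.2 ht.2)) (Real.rpow_le_rpow hPn h2 ht.1)
    (Real.rpow_nonneg hPn _) (Real.rpow_nonneg (hQn.trans h1) _)

/-- The arithmetic-geometric step is taken before the limit, where the matrices are positive
definite; both sides of the resulting inequality are continuous. -/
theorem IsKuboAndoMean.quadForm_le {Q P G S : Matrix ι ι ℂ} (hQ : Q.PosSemidef)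
    (hP : P.PosSemidef) (hS : S.PosSemidef) {t : ℝ} (ht : t ∈ Set.Icc (0 : ℝ) 1)
    (hG : IsKuboAndoMean t Q P G) (hGS : (G - S).PosSemidef) (n : ℕ) (w : (Fin n → ι) → ℂ) :
    quadForm (matTensorPow n S) w ≤
      (1 - t) * quadForm (matTensorPow n Q) w + t * quadForm (matTensorPow n P) w := by
  refine (quadForm_le_of_posSemidef_sub (matTensorPow_sub_posSemidef hS hGS n) w).trans ?_
  have hcont : Continuous fun C : Matrix ι ι ℂ => quadForm (matTensorPow n C) w :=
    (continuous_quadForm w).comp (continuous_matTensorPow n)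
  have hreg : ∀ C : Matrix ι ι ℂ, Tendsto
      (fun ε : ℝ => quadForm (matTensorPow n (C + (ε : ℂ) • 1)) w) (𝓝[>] 0)
      (𝓝 (quadForm (matTensorPow n C) w)) := by
    intro C
    have : Continuous fun ε : ℝ => quadForm (matTensorPow n (C + (ε : ℂ) • 1)) w :=
      hcont.comp (by fun_prop)
    simpa using this.continuousWithinAt.tendsto (x := 0) (s := Set.Ioi 0)
  refine le_of_tendsto_of_tendsto ((hcont.tendsto G).comp hG)
    (((hreg Q).const_mul (1 - t)).add ((hreg P).const_mul t)) ?_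
  filter_upwards [self_mem_nhdsWithin] with ε hε
  have hQε := hQ.add_smul_one_posDef hε
  have hPε := hP.add_smul_one_posDef hε
  exact (quadForm_geomMeanPosDef_le hQε hPε ht n w).trans
    (Real.geom_mean_le_arith_mean2_weighted (sub_nonneg.2 ht.2) ht.1
      ((hQε.posSemidef.matTensorPow n).quadForm_nonneg w)
      ((hPε.posSemidef.matTensorPow n).quadForm_nonneg w) (by ring))

end KuboAndo

/-! ### Complete positivity and Choi matrices -/

section Choi

/-- The sum is the compression of M by I ⊗ ⟨1,…,1|. Applying a superoperator through its Choi matrix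
is such a contraction. -/
theorem Matrix.PosSemidef.sum_blocks {P A : Type*} [Fintype P] [Fintype A]
    {M : Matrix (P × A) (P × A) ℂ} (hM : M.PosSemidef) :
    (Matrix.of fun p q => ∑ a, ∑ a', M (p, a) (q, a')).PosSemidef := by
  classical
  let K : Matrix P (P × A) ℂ := Matrix.of fun p q => if q.1 = p then 1 else 0
  have h : (Matrix.of fun p q => ∑ a, ∑ a', M (p, a) (q, a')) = K * M * K.conjTranspose := by
    ext p q
    simp only [Matrix.mul_apply, K, Matrix.of_apply, Matrix.conjTranspose_apply,
      Fintype.sum_prod_type_right, apply_ite star, star_one, star_zero, ite_mul, one_mul, zero_mul,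
      mul_ite, mul_one, mul_zero, Finset.sum_ite_eq', Finset.mem_univ, if_true]
    exact Finset.sum_comm
  rw [h]
  exact hM.mul_mul_conjTranspose_same K

theorem Matrix.PosSemidef.re_trace_mul_nonneg {A : Type*} [Fintype A] {T M : Matrix A A ℂ}
    (hT : T.PosSemidef) (hM : M.PosSemidef) : 0 ≤ (T * M).trace.re := by
  obtain ⟨D, rfl⟩ := hT.exists_eq_conjTranspose_mul_self
  rw [Matrix.mul_assoc, Matrix.trace_mul_comm]
  exact (Complex.nonneg_iff.1 (hM.mul_mul_conjTranspose_same D).trace_nonneg).1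

variable {A : Type u} {B : Type v} {R : Type w}

theorem idTensor_apply (N : Superop A B) (X : Matrix (R × A) (R × A) ℂ) (p q : R × B) :
    idTensor R N X p q = N (Matrix.of fun a a' => X (p.1, a) (q.1, a')) p.2 q.2 := rfl

theorem idTensor_sub (N M : Superop A B) : idTensor R (M - N) = idTensor R M - idTensor R N := rfl

theorem idTensor_smul (c : ℂ) (N : Superop A B) : idTensor R (c • N) = c • idTensor R N := rfl

theorem idTensor_sum {Y : Type*} (s : Finset Y) (N : Y → Superop A B) :
    idTensor R (∑ y ∈ s, N y) = ∑ y ∈ s, idTensor R (N y) := by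
  ext X p q
  simp [idTensor_apply, LinearMap.sum_apply, Matrix.sum_apply]

theorem IsCP.idTensor_posSemidef [Finite R] {N : Superop A B} (hN : IsCP N)
    {X : Matrix (R × A) (R × A) ℂ} (hX : X.PosSemidef) : (idTensor R N X).PosSemidef := by
  obtain ⟨k, ⟨e⟩⟩ := Finite.exists_equiv_fin R
  have h := hN k _ (hX.submatrix (Prod.map e.symm id))
  convert h.submatrix (Prod.map e id) using 1
  ext p q
  simp [idTensor_apply]

theorem isCP_idTensor {N : Superop A B} [Finite R] (hN : IsCP N) : IsCP (idTensor R N) := by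
  intro k X hX
  exact (hN.idTensor_posSemidef (R := Fin k × R)
    (hX.submatrix (Equiv.prodAssoc (Fin k) R A))).submatrix (Equiv.prodAssoc (Fin k) R B).symm

theorem isCP_of_idTensor {N : Superop A B} [Nonempty R] (hN : IsCP (idTensor R N)) : IsCP N := by
  intro k X hX
  obtain ⟨r⟩ := ‹Nonempty R›
  exact (hN k _ (hX.submatrix fun p : Fin k × R × A => (p.1, p.2.2))).submatrix
    fun p : Fin k × B => (p.1, r, p.2)

variable [DecidableEq A]

theorem choi_apply (N : Superop A B) (p q : A × B) :
    choi N p q = N (Matrix.single p.1 q.1 1) p.2 q.2 := rfl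

theorem choi_sub (N M : Superop A B) : choi (M - N) = choi M - choi N := rfl

theorem choi_smul (c : ℂ) (N : Superop A B) : choi (c • N) = c • choi N := rfl

theorem choi_sum {Y : Type*} (s : Finset Y) (N : Y → Superop A B) :
    choi (∑ y ∈ s, N y) = ∑ y ∈ s, choi (N y) := by
  ext p q
  simp [choi_apply, LinearMap.sum_apply, Matrix.sum_apply]

/-- The unnormalized maximally entangled vector. -/
def maxEntangledVec (A : Type*) [DecidableEq A] : A × A → ℂ := fun p => if p.1 = p.2 then 1 else 0

theorem idTensor_maxEntangled (N : Superop A B) :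
    idTensor A N (Matrix.vecMulVec (maxEntangledVec A) (star (maxEntangledVec A))) = choi N := by
  ext p q
  rw [idTensor_apply, choi_apply]
  suffices h : (Matrix.of fun a a' =>
      Matrix.vecMulVec (maxEntangledVec A) (star (maxEntangledVec A)) (p.1, a) (q.1, a')) = Matrix.single p.1 q.1 1 by
    rw [h]
  ext a a'
  simp only [Matrix.of_apply, Matrix.vecMulVec_apply, maxEntangledVec, Pi.star_apply,
    Matrix.single_apply]
  split_ifs <;> simp_all

variable [Fintype A]

theorem superop_apply (N : Superop A B) (Z : Matrix A A ℂ) (b b' : B) :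
    N Z b b' = ∑ a, ∑ a', Z a a' * choi N (a, b) (a', b') := by
  conv_lhs => rw [Matrix.matrix_eq_sum_single Z]
  simp only [map_sum, Matrix.sum_apply]
  refine Finset.sum_congr rfl fun a _ => Finset.sum_congr rfl fun a' _ => ?_
  have h : Matrix.single a a' (Z a a') = Z a a' • Matrix.single a a' (1 : ℂ) := by
    simp [Matrix.smul_single]
  rw [h, map_smul, Matrix.smul_apply, smul_eq_mul, choi_apply]

/-- The superoperator with a given Choi matrix. -/
def superopOfChoi (G : Matrix (A × B) (A × B) ℂ) : Superop A B where
  toFun Z := Matrix.of fun b b' => ∑ a, ∑ a', Z a a' * G (a, b) (a', b')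
  map_add' X Y := by
    ext b b'
    simp [add_mul, Finset.sum_add_distrib]
  map_smul' c X := by
    ext b b'
    simp [Finset.mul_sum, mul_assoc]

theorem choi_superopOfChoi (G : Matrix (A × B) (A × B) ℂ) : choi (superopOfChoi G) = G := by
  ext ⟨a, b⟩ ⟨a', b'⟩
  simp only [choi_apply, superopOfChoi, LinearMap.coe_mk, AddHom.coe_mk, Matrix.of_apply]
  rw [Finset.sum_eq_single a, Finset.sum_eq_single a'] <;>
    simp +contextual [Matrix.single_apply, eq_comm]

theorem IsCP.choi_posSemidef {N : Superop A B} (hN : IsCP N) : (choi N).PosSemidef := by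
  rw [← idTensor_maxEntangled]
  exact hN.idTensor_posSemidef (Matrix.posSemidef_vecMulVec_self_star _)

theorem choi_tensorPow (n : ℕ) (N : Superop A B) :
    choi (tensorPow n N) = (matTensorPow n (choi N)).submatrix
      (Equiv.arrowProdEquivProdArrow (Fin n) (fun _ => A) fun _ => B).symm
      (Equiv.arrowProdEquivProdArrow (Fin n) (fun _ => A) fun _ => B).symm := by
  ext ⟨a, b⟩ ⟨a', b'⟩
  simp only [choi_apply, tensorPow, LinearMap.coe_mk, AddHom.coe_mk, Matrix.of_apply,
    Matrix.submatrix_apply, matTensorPow_apply, Equiv.arrowProdEquivProdArrow_symm_apply]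
  rw [Finset.sum_eq_single a, Finset.sum_eq_single a'] <;>
    simp +contextual [Matrix.single_apply, eq_comm]

variable [Fintype B]

theorem isCP_of_choi_posSemidef {N : Superop A B} (hN : (choi N).PosSemidef) : IsCP N := by
  intro k X hX
  have h := ((hX.kronecker hN).submatrix
    fun p : (Fin k × B) × A => ((p.1.1, p.2), (p.2, p.1.2))).sum_blocks
  convert h using 1
  ext p q
  rw [idTensor_apply, superop_apply]
  rfl

theorem isCP_iff_choi_posSemidef {N : Superop A B} : IsCP N ↔ (choi N).PosSemidef :=
  ⟨IsCP.choi_posSemidef, isCP_of_choi_posSemidef⟩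

theorem isCP_tensorPow {N : Superop A B} (hN : IsCP N) (n : ℕ) : IsCP (tensorPow n N) := by
  rw [isCP_iff_choi_posSemidef, choi_tensorPow]
  exact (hN.choi_posSemidef.matTensorPow n).submatrix _

theorem trace_superop_apply (N : Superop A B) (Z : Matrix A A ℂ) :
    (N Z).trace = ∑ a, ∑ a', Z a a' * (N (Matrix.single a a' 1)).trace := by
  simp only [Matrix.trace, Matrix.diag_apply, superop_apply N Z, Finset.mul_sum, choi_apply]
  rw [Finset.sum_comm]
  exact Finset.sum_congr rfl fun a _ => Finset.sum_comm

theorem isCPTP_tensorPow {N : Superop A B} (hN : IsCPTP N) (n : ℕ) :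
    IsCPTP (tensorPow n N) := by
  classical
  refine ⟨isCP_tensorPow hN.1 n, fun Z => ?_⟩
  have h : ∀ a a' : Fin n → A, (tensorPow n N (Matrix.single a a' 1)).trace =
      if a = a' then 1 else 0 := by
    intro a a'
    have h1 : (tensorPow n N (Matrix.single a a' 1)).trace =
        ∏ i, (N (Matrix.single (a i) (a' i) 1)).trace := by
      simp only [Matrix.trace, Matrix.diag_apply]
      rw [Finset.prod_univ_sum, Fintype.piFinset_univ]
      refine Finset.sum_congr rfl fun b _ => ?_
      have := congrFun (congrFun (choi_tensorPow n N) (a, b)) (a', b)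
      simpa [choi_apply] using this
    rw [h1]
    simp only [hN.2]
    split_ifs with h
    · subst h; simp
    · obtain ⟨i, hi⟩ := Function.ne_iff.1 h
      exact Finset.prod_eq_zero (Finset.mem_univ i) (Matrix.trace_single_eq_of_ne _ _ _ hi)
  rw [trace_superop_apply]
  simp only [h]
  simp [Matrix.trace]

end Choi

/-! ### Supermaps -/

section Supermap

theorem IsCPSupermap.map_isCP {A A' : Type u} {B B' : Type v}
    {Θ : Superop A B →ₗ[ℂ] Superop A' B'} (hΘ : IsCPSupermap Θ) {N : Superop A B} (hN : IsCP N) :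
    IsCP (Θ N) := by
  -- A one-dimensional ancilla recovers the action of Θ on a single map.
  have h := hΘ 1 1 (idTensor (Fin 1) N) (isCP_idTensor hN)
  refine isCP_of_idTensor (R := Fin 1) ?_
  convert h using 1
  refine LinearMap.ext fun X => ?_
  ext p q
  have hb : ∀ c c' d d' : Fin 1, superopBlock (idTensor (Fin 1) N) c c' d d' = N := by
    intro c c' d d'
    refine LinearMap.ext fun X => ?_
    ext b b'
    rw [superopBlock, LinearMap.coe_mk, AddHom.coe_mk, Matrix.of_apply, idTensor_kronecker]
    simp [Subsingleton.elim c d, Subsingleton.elim c' d']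
  simp [supermapOnHalf, hb, idTensor_apply, Subsingleton.elim p.1 0, Subsingleton.elim q.1 0]

theorem supermapOnHalf_id {C D : Type w} {A : Type u} {B : Type v} [Fintype C] [DecidableEq C]
    (Λ : Superop (C × A) (D × B)) : supermapOnHalf LinearMap.id Λ = Λ := by
  refine LinearMap.ext fun X => ?_
  ext p q
  have hX : X = ∑ c, ∑ c', Matrix.single c c' (1 : ℂ) ⊗ₖ
      (Matrix.of fun a a' => X (c, a) (c', a')) := by
    ext ⟨c, a⟩ ⟨c', a'⟩
    simp only [Matrix.sum_apply, Matrix.kroneckerMap_apply, Matrix.of_apply]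
    rw [Finset.sum_eq_single c, Finset.sum_eq_single c'] <;>
      simp +contextual [Matrix.single_apply, eq_comm]
  conv_rhs => rw [hX]
  simp only [map_sum, Matrix.sum_apply]
  rfl

theorem isSuperchannel_id {A : Type u} {B : Type v} [Fintype A] [Fintype B] :
    IsSuperchannel (LinearMap.id : Superop A B →ₗ[ℂ] Superop A B) :=
  ⟨fun k l Λ hΛ => by rwa [supermapOnHalf_id], fun _ hN => hN⟩

theorem IsSuperchannel.isTensorPowSuperchannel {A A' : Type u} {B B' : Type v} [Fintype A]
    [DecidableEq A] [Fintype A'] [Fintype B] [Fintype B'] {n : ℕ}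
    {Θ : Superop (Fin n → A) (Fin n → B) →ₗ[ℂ] Superop A' B'} (hΘ : IsSuperchannel Θ) :
    IsTensorPowSuperchannel n Θ :=
  ⟨hΘ.1, fun _ hN => hΘ.2 _ (isCPTP_tensorPow hN n)⟩

end Supermap

/-! ### Adaptive strategies -/

section Adaptive

/-- One use of `F j` is a contraction of its Choi factor with `X j`, performed while the
coefficients `Z j` are kept as a spectator system. -/
theorem posSemidef_sum_kronecker_idTensor {A B R S J : Type*} [Fintype A] [DecidableEq A]
    [Fintype B] [Fintype R] [Fintype S] [Fintype J] (F : J → Superop A B)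
    (Z : J → Matrix S S ℂ) (X : J → Matrix (R × A) (R × A) ℂ)
    (h : (∑ j, (Z j ⊗ₖ choi (F j)) ⊗ₖ X j).PosSemidef) :
    (∑ j, Z j ⊗ₖ idTensor R (F j) (X j)).PosSemidef := by
  have h' := (h.submatrix
    fun p : (S × R × B) × A => ((p.1.1, (p.2, p.1.2.2)), (p.1.2.1, p.2))).sum_blocks
  convert h' using 1
  ext p q
  simp only [Matrix.sum_apply, Matrix.kroneckerMap_apply, idTensor_apply, Matrix.of_apply,
    Matrix.submatrix_apply, superop_apply (F _), Finset.mul_sum]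
  rw [Finset.sum_comm]
  refine Finset.sum_congr rfl fun a _ => ?_
  rw [Finset.sum_comm]
  exact Finset.sum_congr rfl fun a' _ => Finset.sum_congr rfl fun j _ => by ring

/-- Adaptive strategies preserve positivity of combinations of tensor powers. -/
theorem posSemidef_sum_kronecker_adaptiveSuperop {A B : Type u} [Fintype A] [DecidableEq A]
    [Fintype B] {J : Type v} [Fintype J] (F : J → Superop A B) (R : ℕ → Type u)
    [∀ i, Fintype (R i)] (𝒜 : ∀ i, Superop (R i × B) (R (i + 1) × A))
    {φ : Matrix (R 0 × A) (R 0 × A) ℂ} (hφ : φ.PosSemidef) (k : ℕ)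
    (h𝒜 : ∀ i < k, IsCP (𝒜 i)) (S : Type u) [Fintype S] (Z : J → Matrix S S ℂ)
    (h : (∑ j, Z j ⊗ₖ matTensorPow (k + 1) (choi (F j))).PosSemidef) :
    (∑ j, Z j ⊗ₖ adaptiveSuperop (F j) R 𝒜 k φ).PosSemidef := by
  induction k generalizing S with
  | zero =>
    refine posSemidef_sum_kronecker_idTensor F Z (fun _ => φ) ?_
    have h' : ∑ j, (Z j ⊗ₖ choi (F j)) ⊗ₖ φ =
        ((∑ j, Z j ⊗ₖ matTensorPow (0 + 1) (choi (F j))).submatrix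
          (fun p : S × A × B => (p.1, fun _ : Fin 1 => p.2))
          fun p : S × A × B => (p.1, fun _ : Fin 1 => p.2)) ⊗ₖ φ := by
      ext p q
      simp [Matrix.sum_apply, Finset.sum_mul]
    rw [h']
    exact (h.submatrix _).kronecker hφ
  | succ k ih =>
    refine posSemidef_sum_kronecker_idTensor F Z
      (fun j => 𝒜 k (adaptiveSuperop (F j) R 𝒜 k φ)) ?_
    -- One Choi factor is stored in the spectator system for the last use, which is why the
    -- induction generalizes over `S`.
    have h1 : (∑ j, (Z j ⊗ₖ choi (F j)) ⊗ₖ matTensorPow (k + 1) (choi (F j))).PosSemidef := by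
      convert h.submatrix fun p : (S × A × B) × (Fin (k + 1) → A × B) =>
        (p.1.1, (Fin.cons p.1.2 p.2 : Fin (k + 2) → A × B)) using 1
      ext p q
      simp [Matrix.sum_apply, Fin.prod_univ_succ (n := k + 1), mul_assoc]
    have h2 := (h𝒜 k k.lt_succ_self).idTensor_posSemidef
      (ih (fun i hi => h𝒜 i (hi.trans k.lt_succ_self)) (S × A × B) _ h1)
    simpa only [map_sum, idTensor_kronecker] using h2

theorem adaptiveSuperop_succ {A : Type u} {B : Type v} (E : Superop A B) (R : ℕ → Type w)
    (𝒜 : ∀ i, Superop (R i × B) (R (i + 1) × A)) (k : ℕ) :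
    adaptiveSuperop E R 𝒜 (k + 1) =
      adaptiveSuperop E (fun i => R (i + 1)) (fun i => 𝒜 (i + 1)) k ∘ₗ 𝒜 0 ∘ₗ
        idTensor (R 0) E := by
  induction k with
  | zero => rfl
  | succ k ih =>
    rw [adaptiveSuperop, ih]
    rfl

/-- The channel that relabels the basis. -/
def reindexSuperop {A : Type u} {B : Type v} (e : A ≃ B) : Superop A B where
  toFun X := X.submatrix e.symm e.symm
  map_add' _ _ := rfl
  map_smul' _ _ := rfl

theorem trace_submatrix_equiv {A B : Type*} [Fintype A] [Fintype B] (e : A ≃ B)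
    (X : Matrix B B ℂ) : (X.submatrix e e).trace = X.trace :=
  Fintype.sum_equiv e _ _ fun _ => rfl

theorem isCPTP_reindexSuperop {A : Type u} {B : Type v} [Fintype A] [Fintype B] (e : A ≃ B) :
    IsCPTP (reindexSuperop e) :=
  ⟨fun _ _ hX => hX.submatrix (Prod.map id e.symm), fun X => trace_submatrix_equiv e.symm X⟩

theorem tensorPow_apply {A : Type u} {B : Type v} [Fintype A] [DecidableEq A] (n : ℕ)
    (F : Superop A B) (X : Matrix (Fin n → A) (Fin n → A) ℂ) (b b' : Fin n → B) :
    tensorPow n F X b b' = ∑ a, ∑ a', X a a' * ∏ i, choi F (a i, b i) (a' i, b' i) := by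
  simp only [mul_comm (X _ _)]
  rfl

theorem sum_fin_succ_fun {A : Type*} [Fintype A] (n : ℕ) (f : (Fin (n + 1) → A) → ℂ) :
    ∑ a, f a = ∑ a : Fin n → A, ∑ x : A, f (Fin.cons x a) := by
  rw [← Fintype.sum_prod_type_right (f := fun p : A × (Fin n → A) => f (Fin.cons p.1 p.2))]
  exact (Fintype.sum_equiv (Fin.consEquiv fun _ => A) _ _ fun _ => rfl).symm

/-- Applying `F` to `n + 1` tensor factors means applying it to the first one and then to the
others. -/
theorem idTensor_tensorPow_succ {A : Type u} {B : Type v} {R : Type w} [Fintype A]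
    [DecidableEq A] (n : ℕ) (F : Superop A B)
    (X : Matrix (R × (Fin (n + 1) → A)) (R × (Fin (n + 1) → A)) ℂ)
    (p q : R × (Fin (n + 1) → B)) :
    idTensor R (tensorPow (n + 1) F) X p q =
      idTensor (R × B) (tensorPow n F)
        (Matrix.submatrix (idTensor (R × (Fin n → A)) F (X.submatrix
          (fun s : (R × (Fin n → A)) × A => (s.1.1, (Fin.cons s.2 s.1.2 : Fin (n + 1) → A)))
          fun s : (R × (Fin n → A)) × A => (s.1.1, (Fin.cons s.2 s.1.2 : Fin (n + 1) → A))))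
          (fun s : (R × B) × (Fin n → A) => ((s.1.1, s.2), s.1.2))
          fun s : (R × B) × (Fin n → A) => ((s.1.1, s.2), s.1.2))
        ((p.1, p.2 0), Fin.tail p.2) ((q.1, q.2 0), Fin.tail q.2) := by
  rw [idTensor_apply, idTensor_apply, tensorPow_apply, tensorPow_apply, sum_fin_succ_fun]
  refine Finset.sum_congr rfl fun a _ => ?_
  simp only [sum_fin_succ_fun n, Matrix.of_apply, Matrix.submatrix_apply, idTensor_apply,
    superop_apply F, Finset.sum_mul]
  rw [Finset.sum_comm]
  refine Finset.sum_congr rfl fun a' _ => Finset.sum_congr rfl fun x _ =>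
    Finset.sum_congr rfl fun x' _ => ?_
  simp only [Fin.prod_univ_succ, Fin.cons_zero, Fin.cons_succ, Fin.tail, mul_assoc]

/-- Parallel uses of a superoperator are a special case of adaptive ones. -/
theorem exists_adaptiveSuperop_eq_tensorPow {A B : Type u} [Fintype A] [DecidableEq A] [Fintype B]
    [DecidableEq B] (m : ℕ) (R : Type u) [Fintype R] [DecidableEq R] :
    ∃ (S : ℕ → Type u) (_ : ∀ i, Fintype (S i)) (_ : ∀ i, DecidableEq (S i))
      (𝒜 : ∀ i, Superop (S i × B) (S (i + 1) × A)) (e : R × (Fin (m + 1) → A) ≃ S 0 × A)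
      (f : S m × B ≃ R × (Fin (m + 1) → B)), (∀ i < m, IsCPTP (𝒜 i)) ∧
      ∀ (F : Superop A B) X, adaptiveSuperop F S 𝒜 m (X.submatrix e.symm e.symm) =
        (idTensor R (tensorPow (m + 1) F) X).submatrix f f := by
  induction m generalizing R with
  | zero =>
    -- The zero maps are placeholders: a single use involves no intermediate channel.
    refine ⟨fun _ => R, fun _ => inferInstance, fun _ => inferInstance, fun _ => 0,
      (Equiv.refl R).prodCongr (Equiv.funUnique (Fin 1) A),
      (Equiv.refl R).prodCongr (Equiv.funUnique (Fin 1) B).symm,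
      fun i hi => absurd hi (Nat.not_lt_zero i), fun F X => ?_⟩
    ext p q
    rw [adaptiveSuperop, Matrix.submatrix_apply, idTensor_apply, idTensor_apply, superop_apply,
      tensorPow_apply]
    refine Fintype.sum_equiv (Equiv.funUnique (Fin 1) A).symm _ _ fun a =>
      Fintype.sum_equiv (Equiv.funUnique (Fin 1) A).symm _ _ fun a' => ?_
    simp [Equiv.prodCongr_symm]
  | succ m ih =>
    obtain ⟨S, i₁, i₂, 𝒜, e, f, h𝒜, h⟩ := ih (R × B)
    -- The first memory holds the inputs still waiting. After the first use a relabelling moves the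
    -- output into the reference, and the strategy for `R × B` handles the rest.
    let S' : ℕ → Type u := fun i => Nat.casesOn i (R × (Fin (m + 1) → A)) S
    let g : (R × (Fin (m + 1) → A)) × B ≃ (R × B) × (Fin (m + 1) → A) :=
      ⟨fun s => ((s.1.1, s.2), s.1.2), fun s => ((s.1.1, s.2), s.1.2), fun _ => rfl, fun _ => rfl⟩
    let 𝒜' : ∀ i, Superop (S' i × B) (S' (i + 1) × A) := fun i =>
      match i with
      | 0 => reindexSuperop (g.trans e)
      | i + 1 => 𝒜 i
    let e' : R × (Fin (m + 2) → A) ≃ S' 0 × A :=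
      { toFun := fun s => ((s.1, Fin.tail s.2), s.2 0)
        invFun := fun s : (R × (Fin (m + 1) → A)) × A =>
          (s.1.1, (Fin.cons s.2 s.1.2 : Fin (m + 2) → A))
        left_inv := fun s => by simp
        right_inv := fun s => by simp }
    let f₁ : (R × B) × (Fin (m + 1) → B) ≃ R × (Fin (m + 2) → B) :=
      { toFun := fun s => (s.1.1, (Fin.cons s.1.2 s.2 : Fin (m + 2) → B))
        invFun := fun s => ((s.1, s.2 0), Fin.tail s.2)
        left_inv := fun s => by simp
        right_inv := fun s => by simp }
    refine ⟨S', fun i => ?_, fun i => ?_, 𝒜', e', f.trans f₁, ?_, fun F X => ?_⟩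
    · cases i with
      | zero => exact inferInstanceAs (Fintype (R × (Fin (m + 1) → A)))
      | succ i => exact i₁ i
    · cases i with
      | zero => exact inferInstanceAs (DecidableEq (R × (Fin (m + 1) → A)))
      | succ i => exact i₂ i
    · intro i hi
      cases i with
      | zero => exact isCPTP_reindexSuperop (g.trans e)
      | succ i => exact h𝒜 i (Nat.lt_of_succ_lt_succ hi)
    · rw [adaptiveSuperop_succ]
      let W := (idTensor (R × (Fin (m + 1) → A)) F (X.submatrix e'.symm e'.symm)).submatrix
        g.symm g.symm
      have hW := h F W
      change adaptiveSuperop F S 𝒜 m (W.submatrix e.symm e.symm) = _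
      rw [hW]
      ext p q
      rw [Matrix.submatrix_apply, Matrix.submatrix_apply,
        idTensor_tensorPow_succ (m + 1) F X]
      simp only [Equiv.trans_apply, f₁, Equiv.coe_fn_mk, Fin.cons_zero, Fin.tail_cons]
      rfl

end Adaptive

/-! ### The implications between the domination conditions -/

section Domination

set_option linter.unusedSectionVars false

theorem re_trace_le_sup' {Y ι : Type*} [Fintype Y] [Nonempty Y] [Fintype ι] {μ : Y → ℝ}
    (hμ : μ ∈ stdSimplex ℝ Y) {T : Matrix ι ι ℂ} (hT : T.PosSemidef) (X : Matrix ι ι ℂ)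
    (Z : Y → Matrix ι ι ℂ) (h : (∑ y, (μ y : ℂ) • Z y - X).PosSemidef) :
    (T * X).trace.re ≤
      Finset.univ.sup' Finset.univ_nonempty fun y => (T * Z y).trace.re := by
  have h0 := hT.re_trace_mul_nonneg h
  rw [Matrix.mul_sub, Matrix.trace_sub, Complex.sub_re, sub_nonneg] at h0
  refine h0.trans ?_
  simp only [Matrix.mul_sum, Matrix.trace_sum, Matrix.mul_smul, Matrix.trace_smul, smul_eq_mul,
    Complex.re_sum, Complex.re_ofReal_mul]
  set M := Finset.univ.sup' Finset.univ_nonempty fun y => (T * Z y).trace.re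
  calc ∑ y, μ y * (T * Z y).trace.re ≤ ∑ y, μ y * M := by
        refine Finset.sum_le_sum fun y _ => mul_le_mul_of_nonneg_left ?_ (hμ.1 y)
        exact Finset.le_sup' (fun y => (T * Z y).trace.re) (Finset.mem_univ y)
    _ = M := by rw [← Finset.sum_mul, hμ.2, one_mul]

theorem isState_smul_vecMulVec {ι : Type u} [Fintype ι] {v : ι → ℂ} {c : ℝ} (hc : 0 < c)
    (hv : v ⬝ᵥ star v = c) : IsState (((c⁻¹ : ℝ) : ℂ) • Matrix.vecMulVec v (star v)) := by
  refine ⟨(Matrix.posSemidef_vecMulVec_self_star v).smul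
    (Complex.zero_le_real.2 (inv_nonneg.2 hc.le)), ?_⟩
  rw [Matrix.trace_smul, Matrix.trace_vecMulVec, hv, smul_eq_mul, ← Complex.ofReal_mul,
    inv_mul_cancel₀ hc.ne', Complex.ofReal_one]

/-- The normalized rank-one operator is a projection, so 1 − T = (1 − T)* (1 − T). -/
theorem isTest_smul_vecMulVec {ι : Type u} [Fintype ι] [DecidableEq ι] {v : ι → ℂ} {c : ℝ}
    (hc : 0 < c) (hv : v ⬝ᵥ star v = c) :
    IsTest (((c⁻¹ : ℝ) : ℂ) • Matrix.vecMulVec v (star v)) := by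
  have hT := (isState_smul_vecMulVec hc hv).1
  refine ⟨hT, ?_⟩
  set T := ((c⁻¹ : ℝ) : ℂ) • Matrix.vecMulVec v (star v) with hTdef
  have hTT : T * T = T := by
    rw [hTdef, Matrix.smul_mul, Matrix.mul_smul, Matrix.vecMulVec_mul_vecMulVec, dotProduct_comm,
      hv, smul_smul]
    ext i j
    simp only [Matrix.smul_apply, Matrix.vecMulVec_apply, Pi.smul_apply, smul_eq_mul]
    have : (c : ℂ) ≠ 0 := Complex.ofReal_ne_zero.2 hc.ne'
    push_cast
    field_simp
  have h : 1 - T = (1 - T).conjTranspose * (1 - T) := by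
    rw [Matrix.conjTranspose_sub, Matrix.conjTranspose_one, hT.1.eq, Matrix.mul_sub,
      Matrix.sub_mul, Matrix.sub_mul, hTT]
    simp
  rw [h]
  exact Matrix.posSemidef_conjTranspose_mul_self _

theorem re_trace_smul_vecMulVec_mul {ι : Type*} [Fintype ι] (v : ι → ℂ) (r s : ℝ)
    (C : Matrix ι ι ℂ) :
    (((r : ℂ) • Matrix.vecMulVec v (star v)) * ((s : ℂ) • C)).trace.re =
      r * s * quadForm C v := by
  rw [Matrix.smul_mul, Matrix.mul_smul, Matrix.trace_smul, Matrix.trace_smul,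
    Matrix.vecMulVec_mul, Matrix.trace_vecMulVec, smul_eq_mul, smul_eq_mul,
    Complex.re_ofReal_mul, Complex.re_ofReal_mul, dotProduct_comm, ← Matrix.dotProduct_mulVec,
    mul_assoc]
  rfl

theorem choi_sum_smul_tensorPow_sub {A B : Type*} [Fintype A] [DecidableEq A] {Y : Type*} [Fintype Y]
    (N : Y → Superop A B) (E : Superop A B) (μ : Y → ℝ) (n : ℕ) :
    choi (∑ y, (μ y : ℂ) • tensorPow n (N y) - tensorPow n E) =
      (∑ y, (μ y : ℂ) • matTensorPow n (choi (N y)) - matTensorPow n (choi E)).submatrix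
        (Equiv.arrowProdEquivProdArrow (Fin n) (fun _ => A) fun _ => B).symm
        (Equiv.arrowProdEquivProdArrow (Fin n) (fun _ => A) fun _ => B).symm := by
  rw [choi_sub, choi_sum, choi_tensorPow]
  simp only [choi_smul, choi_tensorPow]
  ext p q
  simp [Matrix.sum_apply]

theorem cpLe_tensorPow_iff {A B : Type*} [Fintype A] [DecidableEq A] [Fintype B] {Y : Type*}
    [Fintype Y] (N : Y → Superop A B) (E : Superop A B) (μ : Y → ℝ) (n : ℕ) :
    CPLe (tensorPow n E) (∑ y, (μ y : ℂ) • tensorPow n (N y)) ↔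
      (∑ y, (μ y : ℂ) • matTensorPow n (choi (N y)) - matTensorPow n (choi E)).PosSemidef := by
  rw [CPLe, isCP_iff_choi_posSemidef, choi_sum_smul_tensorPow_sub,
    Matrix.posSemidef_submatrix_equiv]

theorem quadForm_sum_smul {ι Y : Type*} [Fintype ι] (s : Finset Y) (μ : Y → ℝ)
    (C : Y → Matrix ι ι ℂ) (w : ι → ℂ) :
    quadForm (∑ y ∈ s, (μ y : ℂ) • C y) w = ∑ y ∈ s, μ y * quadForm (C y) w := by
  simp [quadForm, Matrix.sum_mulVec, dotProduct_sum, Matrix.smul_mulVec, dotProduct_smul]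

variable {A B : Type u} [Fintype A] [DecidableEq A] [Fintype B] [DecidableEq B]
  {Y : Type v} [Fintype Y] [Nonempty Y] {N : Y → Superop A B} {E : Superop A B}

/-- The maximally entangled input state and rank-one tests. -/
theorem DominatedParallel.exists_quadForm_le (h : DominatedParallel N E) (n : ℕ)
    (w : (Fin n → A × B) → ℂ) :
    ∃ y, quadForm (matTensorPow n (choi E)) w ≤ quadForm (matTensorPow n (choi (N y))) w := by
  obtain ⟨y₀⟩ := ‹Nonempty Y›
  -- The strategies have n ≥ 1; for n = 0 both tensor powers are empty products and agree.
  rcases Nat.eq_zero_or_pos n with rfl | hn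
  · refine ⟨y₀, le_of_eq ?_⟩
    congr 1
  by_cases hw : w = 0
  · exact ⟨y₀, by simp [hw, quadForm]⟩
  -- Besides making the test nonzero, this index shows that the input space is nonzero, so the
  -- entangled state can be normalized.
  obtain ⟨x₀, hx₀⟩ := Function.ne_iff.1 hw
  have hnormSq : ∀ {ι : Type u} [Fintype ι] (v : ι → ℂ),
      v ⬝ᵥ star v = ((∑ i, Complex.normSq (v i) : ℝ) : ℂ) := by
    intro ι _ v
    simp [dotProduct, Complex.mul_conj]
  let e := (Equiv.arrowProdEquivProdArrow (Fin n) (fun _ => A) fun _ => B).symm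
  let ψ := maxEntangledVec (Fin n → A)
  let D := ∑ p, Complex.normSq (ψ p)
  let v : (Fin n → A) × (Fin n → B) → ℂ := w ∘ e
  let c := ∑ p, Complex.normSq (v p)
  have hD : 0 < D := Finset.sum_pos' (fun p _ => Complex.normSq_nonneg _)
    ⟨(fun i => (x₀ i).1, fun i => (x₀ i).1), Finset.mem_univ _, by simp [ψ, maxEntangledVec]⟩
  have hc : 0 < c := Finset.sum_pos' (fun p _ => Complex.normSq_nonneg _)
    ⟨e.symm x₀, Finset.mem_univ _, Complex.normSq_pos.2 (by simpa [v] using hx₀)⟩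
  have hval : ∀ F : Superop A B,
      ((((c⁻¹ : ℝ) : ℂ) • Matrix.vecMulVec v (star v)) * idTensor (Fin n → A) (tensorPow n F)
        (((D⁻¹ : ℝ) : ℂ) • Matrix.vecMulVec ψ (star ψ))).trace.re =
      c⁻¹ * D⁻¹ * quadForm (matTensorPow n (choi F)) w := by
    intro F
    rw [map_smul, idTensor_maxEntangled, re_trace_smul_vecMulVec_mul, choi_tensorPow,
      quadForm_submatrix]
    congr 2
  have key := h n hn (Fin n → A) _ _ (isState_smul_vecMulVec hD (hnormSq ψ))
    (isTest_smul_vecMulVec hc (hnormSq v))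
  obtain ⟨y, -, hy⟩ := (Finset.le_sup'_iff _).1 key
  rw [hval, hval] at hy
  exact ⟨y, le_of_mul_le_mul_left hy (by positivity)⟩

theorem DominatedParallel.exists_quadForm_le_prod (h : DominatedParallel N E)
    (hN : ∀ y, IsCP (N y)) (hE : IsCP E) :
    ∃ μ ∈ stdSimplex ℝ Y, ∀ n w, quadForm (matTensorPow n (choi E)) w ≤
      ∏ y, quadForm (matTensorPow n (choi (N y))) w ^ μ y :=
  exists_stdSimplex_quadForm_le_prod hE.choi_posSemidef (fun y => (hN y).choi_posSemidef)
    h.exists_quadForm_le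

theorem dominatedMixture_of_quadForm_le (hN : ∀ y, IsCP (N y)) (hE : IsCP E) {μ : Y → ℝ}
    (hμ : μ ∈ stdSimplex ℝ Y)
    (h : ∀ n w, quadForm (matTensorPow n (choi E)) w ≤
      ∑ y, μ y * quadForm (matTensorPow n (choi (N y))) w) : DominatedMixture N E := by
  refine ⟨μ, hμ, fun n _ => (cpLe_tensorPow_iff N E μ n).2 ?_⟩
  refine posSemidef_sub_of_quadForm_le (hE.choi_posSemidef.matTensorPow n).1 ?_ fun w => ?_
  · exact (Matrix.posSemidef_sum _ fun y _ => ((hN y).choi_posSemidef.matTensorPow n).smul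
      (Complex.zero_le_real.2 (hμ.1 y))).1
  · rw [quadForm_sum_smul]
    exact h n w

theorem DominatedParallel.dominatedMixture (h : DominatedParallel N E)
    (hN : ∀ y, IsCP (N y)) (hE : IsCP E) : DominatedMixture N E := by
  obtain ⟨μ, hμ, hle⟩ := h.exists_quadForm_le_prod hN hE
  refine dominatedMixture_of_quadForm_le hN hE hμ fun n w => (hle n w).trans ?_
  exact Real.geom_mean_le_arith_mean_weighted _ _ _ (fun y _ => hμ.1 y) hμ.2
    fun y _ => ((hN y).choi_posSemidef.matTensorPow n).quadForm_nonneg w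

theorem DominatedMixture.dominatedTensorPowGeneral (h : DominatedMixture N E) :
    DominatedTensorPowGeneral N E := by
  intro n hn R A' B' _ _ _ _ _ _ Θ φ T hΘ hφ hT
  obtain ⟨μ, hμ, hle⟩ := h
  refine re_trace_le_sup' hμ hT.1 _ (fun y => idTensor R (Θ (tensorPow n (N y))) φ) ?_
  have h1 := (hΘ.1.map_isCP (hle n hn)).idTensor_posSemidef (R := R) hφ.1
  simpa only [map_sub, map_sum, map_smul, idTensor_sub, idTensor_sum, idTensor_smul,
    LinearMap.sub_apply, LinearMap.sum_apply, LinearMap.smul_apply] using h1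

theorem DominatedTensorPowGeneral.dominatedGeneral (h : DominatedTensorPowGeneral N E) :
    DominatedGeneral N E :=
  fun n hn R A' B' _ _ _ _ _ _ Θ φ T hΘ hφ hT =>
    h n hn R A' B' Θ φ T hΘ.isTensorPowSuperchannel hφ hT

theorem DominatedGeneral.dominatedParallel (h : DominatedGeneral N E) : DominatedParallel N E :=
  fun n hn R _ _ φ T hφ hT =>
    h n hn R (Fin n → A) (Fin n → B) LinearMap.id φ T isSuperchannel_id hφ hT

theorem DominatedMixture.dominatedAdaptive (h : DominatedMixture N E) :
    DominatedAdaptive N E := by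
  intro m R _ _ 𝒜 φ T h𝒜 hφ hT
  obtain ⟨μ, hμ, hle⟩ := h
  refine re_trace_le_sup' hμ hT.1 _ (fun y => adaptiveSuperop (N y) R 𝒜 m φ) ?_
  -- The difference mixture minus `E` becomes one signed sum, with coefficient −1 at `none`, to fit
  -- the lemma on combinations of tensor powers.
  let F : Option Y → Superop A B := fun j => j.elim E N
  let Z : Option Y → Matrix PUnit.{u + 1} PUnit.{u + 1} ℂ := fun j =>
    Matrix.of fun _ _ => j.elim (-1) fun y => (μ y : ℂ)
  have h1 : (∑ j, Z j ⊗ₖ matTensorPow (m + 1) (choi (F j))).PosSemidef := by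
    convert ((cpLe_tensorPow_iff N E μ (m + 1)).1 (hle (m + 1) m.succ_pos)).submatrix
      fun p : PUnit.{u + 1} × (Fin (m + 1) → A × B) => p.2 using 1
    ext p q
    simp [Fintype.sum_option, F, Z, Matrix.sum_apply]
    ring
  have h2 := posSemidef_sum_kronecker_adaptiveSuperop F R 𝒜 hφ.1 m
    (fun i hi => (h𝒜 i hi).1) PUnit Z h1
  convert h2.submatrix fun p : R m × B => (PUnit.unit, p) using 1
  ext p q
  simp [Fintype.sum_option, F, Z, Matrix.sum_apply]
  ring

theorem DominatedAdaptive.dominatedParallel (h : DominatedAdaptive N E) :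
    DominatedParallel N E := by
  intro n hn R _ _ φ T hφ hT
  obtain ⟨m, rfl⟩ : ∃ m, n = m + 1 := ⟨n - 1, by omega⟩
  obtain ⟨S, _, _, 𝒜, e, f, h𝒜, heq⟩ := exists_adaptiveSuperop_eq_tensorPow (A := A) (B := B) m R
  have key := h m S 𝒜 (φ.submatrix e.symm e.symm) (T.submatrix f f) h𝒜
    ⟨hφ.1.submatrix _, by rw [trace_submatrix_equiv, hφ.2]⟩
    ⟨hT.1.submatrix _, by
      rw [← Matrix.submatrix_one_equiv f]
      exact hT.2.submatrix f⟩
  simpa only [heq, Matrix.submatrix_mul_equiv, trace_submatrix_equiv] using key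

theorem domination_tfae (hN : ∀ y, IsCP (N y)) (hE : IsCP E) :
    [DominatedGeneral N E, DominatedTensorPowGeneral N E, DominatedAdaptive N E,
      DominatedParallel N E, DominatedMixture N E].TFAE := by
  tfae_have 5 → 2 := fun h => h.dominatedTensorPowGeneral
  tfae_have 2 → 1 := fun h => h.dominatedGeneral
  tfae_have 1 → 4 := fun h => h.dominatedParallel
  tfae_have 5 → 3 := fun h => h.dominatedAdaptive
  tfae_have 3 → 4 := fun h => h.dominatedParallel
  tfae_have 4 → 5 := fun h => h.dominatedMixture hN hE
  tfae_finish

theorem DominatedParallel.exists_isKuboAndoMeanCP (h : DominatedParallel N E)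
    (hN : ∀ y, IsCP (N y)) (hE : IsCP E) {y₁ y₂ : Y} (hne : y₁ ≠ y₂)
    (hY : ∀ y, y = y₁ ∨ y = y₂) :
    ∃ t ∈ Set.Icc (0 : ℝ) 1, ∃ G : Superop A B,
      IsKuboAndoMeanCP t (N y₂) (N y₁) G ∧ CPLe E G := by
  classical
  have huniv : (Finset.univ : Finset Y) = {y₁, y₂} := by
    ext y; simpa using hY y
  obtain ⟨μ, hμ, hle⟩ := h.exists_quadForm_le_prod hN hE
  have hsum : μ y₁ + μ y₂ = 1 := by
    rw [← hμ.2, huniv, Finset.sum_pair hne]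
  -- The weight t is the mass at `y₁`, the second argument of the mean; `y₂` receives 1 − t.
  have ht : μ y₁ ∈ Set.Icc (0 : ℝ) 1 := ⟨hμ.1 y₁, by linarith [hμ.1 y₂]⟩
  obtain ⟨G, hG, hGE⟩ := exists_isKuboAndoMean_of_quadForm_le (hN y₂).choi_posSemidef
    (hN y₁).choi_posSemidef hE.choi_posSemidef ht fun n w => by
      have := hle n w
      rw [huniv, Finset.prod_pair hne, mul_comm] at this
      rwa [← eq_sub_iff_add_eq'.2 hsum]
  refine ⟨μ y₁, ht, superopOfChoi G, ?_, ?_⟩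
  · rwa [IsKuboAndoMeanCP, choi_superopOfChoi]
  · rwa [CPLe, isCP_iff_choi_posSemidef, choi_sub, choi_superopOfChoi]

theorem dominatedMixture_of_isKuboAndoMeanCP (hN : ∀ y, IsCP (N y)) (hE : IsCP E) {y₁ y₂ : Y}
    (hne : y₁ ≠ y₂) (hY : ∀ y, y = y₁ ∨ y = y₂) {t : ℝ} (ht : t ∈ Set.Icc (0 : ℝ) 1)
    {G : Superop A B} (hG : IsKuboAndoMeanCP t (N y₂) (N y₁) G) (hEG : CPLe E G) :
    DominatedMixture N E := by
  classical
  have huniv : (Finset.univ : Finset Y) = {y₁, y₂} := by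
    ext y; simpa using hY y
  refine dominatedMixture_of_quadForm_le (μ := fun y => if y = y₁ then t else 1 - t) hN hE
    ⟨fun y => ?_, ?_⟩ fun n w => ?_
  · dsimp only
    split_ifs
    · exact ht.1
    · exact sub_nonneg.2 ht.2
  · rw [huniv, Finset.sum_pair hne, if_pos rfl, if_neg hne.symm]
    ring
  · rw [huniv, Finset.sum_pair hne, if_pos rfl, if_neg hne.symm, add_comm]
    refine IsKuboAndoMean.quadForm_le (hN y₂).choi_posSemidef (hN y₁).choi_posSemidef
      hE.choi_posSemidef ht hG ?_ n w
    rw [← choi_sub]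
    exact hEG.choi_posSemidef

end Domination

theorem mainTheorem11 {A B : Type u} [Fintype A] [DecidableEq A] [Fintype B] [DecidableEq B]
    {Y : Type v} [Fintype Y] [Nonempty Y] (N : Y → Superop A B) (E : Superop A B)
    (hN : ∀ y, IsCP (N y)) (hE : IsCP E) :
    [DominatedGeneral N E, DominatedTensorPowGeneral N E, DominatedAdaptive N E,
      DominatedParallel N E, DominatedMixture N E].TFAE ∧
    ∀ y₁ y₂ : Y, y₁ ≠ y₂ → (∀ y, y = y₁ ∨ y = y₂) →
      [DominatedGeneral N E, DominatedTensorPowGeneral N E, DominatedAdaptive N E,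
        DominatedParallel N E, DominatedMixture N E,
        ∃ t ∈ Set.Icc (0 : ℝ) 1, ∃ G : Superop A B,
          IsKuboAndoMeanCP t (N y₂) (N y₁) G ∧ CPLe E G].TFAE := by
  have h := domination_tfae hN hE
  refine ⟨h, fun y₁ y₂ hne hY => ?_⟩
  tfae_have 1 ↔ 2 := h.out 0 1
  tfae_have 1 ↔ 3 := h.out 0 2
  tfae_have 1 ↔ 4 := h.out 0 3
  tfae_have 1 ↔ 5 := h.out 0 4
  tfae_have 4 → 6 := fun h => h.exists_isKuboAndoMeanCP hN hE hne hY
  tfae_have 6 → 5 := fun ⟨t, ht, G, hG, hEG⟩ =>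
    dominatedMixture_of_isKuboAndoMeanCP hN hE hne hY ht hG hEG
  tfae_finish
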